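/- Conventions. Entropies are in bits. A quantum polynomial-time (QPT) algorithm is a family of quantum circuits made of two-qubit unitary gates and ancillas initialised in $|0\rangle$, whose size (gates plus ancillas) is polynomial in the security parameter; it outputs either a state (discarding the other qubits) or a measured bit. All families are indexed by $n$, with security parameter $\lambda=\lambda(n)$, and $\mathrm{negl}(\lambda)$ denotes a function that is eventually smaller than every inverse power of $\lambda$. The $(n,m)$ generalized Hilbert–Schmidt ensemble (GHSE) is the law of $\mathrm{tr}_m|\psi\rangle\langle\psi|$ for a Haar random $(n+m)$-qubit pure state $\psi$. A keyed family of $n$-qubit states $\rho_k$, $k\in\{0,1\}^{\lambda}$, is a VPRDM with mixedness parameter $m=m(n)$ if (i) a QPT algorithm maps $k$ to $\rho_k$; (ii) for every $t=\mathrm{poly}(n)$ and every QPT algorithm $\mathcal A$, $|\Pr_k[\mathcal A(\rho_k^{\otimes t})=1]-\Pr_{\rho\leftarrow \mathrm{GHSE}(n,m)}[\mathcal A(\rho^{\otimes t})=1]|=\mathrm{negl}(\lambda)$; (iii) a QPT algorithm $\mathcal V$ satisfies $\Pr[\mathcal V(\rho_k,k)=1]=1$ for all $k$ and $\Pr_{k,\,k'\neq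 k}[\mathcal V(\rho_k,k')=1]=\mathrm{negl}(\lambda)$. Families $\nu_0,\nu_1$ of $n$-qubit states form an EFI pair if for each $b$ a QPT algorithm prepares $\nu_b$, $\|\nu_0-\nu_1\|_1=\Omega(1/\mathrm{poly}(\lambda))$, and $|\Pr[\mathcal A(\nu_0)=1]-\Pr[\mathcal A(\nu_1)=1]|=\mathrm{negl}(\lambda)$ for every QPT algorithm $\mathcal A$. Setting. Let $0<c<\gamma<1$, $\lambda=\lfloor cn\rfloor$, $m_0=m_0(n)\le n$ with $m_0=\mathrm{polylog}(n)$, and $m_1=\lceil\gamma n\rceil$. For $b\in\{0,1\}$ let $U^{b}_k$, $k\in\{0,1\}^{\lambda}$, be $n$-qubit unitaries such that the states $$\rho^{b}_k=U^b_k\big(|0\rangle\langle 0|^{\otimes (n-m_b)}\otimes I/2^{m_b}\big)U_k^{b\dagger}$$ form a VPRDM with mixedness parameter $m_b$, and put $\nu_b=2^{-\lambda}\sum_k\rho^b_k$. Let $\Lambda_p(\rho)=(1-\tfrac{3p}{4})\rho+\tfrac p4\sum_{\alpha\in\{x,y,z\}}\sigma^\alpha\rho\sigma^\alpha$ be the single-qubit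 depolarizing channel, and let $p=p_n\in[0,1]$. Claim. (1) If there is a non-zero polynomial $P$ with natural-number coefficients such that, for all sufficiently large $n$, $$H(\{1-\tfrac{3p_n}{4},\tfrac{p_n}{4},\tfrac{p_n}{4},\tfrac{p_n}{4}\})\le \gamma-c-\frac{m_0}{n}-\frac{1}{P(n)},$$ then $\Lambda_{p_n}^{\otimes n}(\nu_0)$, $\Lambda_{p_n}^{\otimes n}(\nu_1)$ form an EFI pair. (2) Let $c=\tfrac12 10^{-4}$ and $\gamma=1-c$. For every $a\in\mathbb N$ and every function $g(n)=O((\log n)^a/n)$, if $p_n<\tfrac14-g(n)$ for all sufficiently large $n$, then $\Lambda_{p_n}^{\otimes n}(\nu_0)$, $\Lambda_{p_n}^{\otimes n}(\nu_1)$ form an EFI pair. -/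

import Mathlib

open scoped Matrix
open Filter MeasureTheory

noncomputable section

namespace NoisyEFI

/-! ### Registers of qubits, states -/

/-- Operators on a register whose qubits are labelled by `Q`, written in the computational basis
`Q → Bool`. -/
abbrev Op (Q : Type) : Type := Matrix (Q → Bool) (Q → Bool) ℂ

/-- The basis state `|k⟩⟨k|`. -/
def basisState {Q : Type} (k : Q → Bool) : Op Q := by
  classical
  exact fun x y => if x = k ∧ y = k then 1 else 0

/-- The tensor product of two operators on disjoint registers. -/
def tensor {I J : Type} (M : Op I) (N : Op J) : Op (I ⊕ J) :=
  fun x y => M (x ∘ Sum.inl) (y ∘ Sum.inl) * N (x ∘ Sum.inr) (y ∘ Sum.inr)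

/-- The tensor power `M^{⊗ t}`. -/
def tensorPow {I : Type} (t : ℕ) (M : Op I) : Op (Fin t × I) :=
  fun x y => ∏ a : Fin t, M (fun i => x (a, i)) (fun i => y (a, i))

/-- The reduced operator on the qubits selected by `e`; all other qubits are traced out. -/
def reduce {Q O : Type} [Fintype Q] [DecidableEq Q] [DecidableEq O]
    (e : O ↪ Q) (M : Op Q) : Op O := by
  classical
  exact fun x y => ∑ s : Q → Bool, ∑ s' : Q → Bool,
    if s ∘ e = x ∧ s' ∘ e = y ∧ ∀ q, q ∉ Set.range e → s q = s' q then M s s' else 0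

/-- The trace norm `‖A‖₁ = tr √(Aᴴ A)`, i.e. the sum of the singular values. -/
def traceNorm {ι : Type} [Fintype ι] [DecidableEq ι] (A : Matrix ι ι ℂ) : ℝ :=
  ∑ i, Real.sqrt ((Matrix.isHermitian_conjTranspose_mul_self A).eigenvalues i)

/-! ### Quantum circuits and their size -/

/-- An arbitrary two-qubit unitary gate, applied to two distinct qubits of the register `Q`. -/
structure QGate (Q : Type) where
  fst : Q
  snd : Q
  ne : fst ≠ snd
  mat : Matrix.unitaryGroup (Bool × Bool) ℂ

/-- The action of a gate on the whole register: the identity on all other qubits. -/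
def QGate.op {Q : Type} (g : QGate Q) : Op Q := by
  classical
  exact fun x y => if ∀ q, q ≠ g.fst → q ≠ g.snd → x q = y q then
    (g.mat : Matrix (Bool × Bool) (Bool × Bool) ℂ) (x g.fst, x g.snd) (y g.fst, y g.snd) else 0

/-- A quantum circuit with input register `I` and `anc` ancilla qubits, which start in `|0⟩`. -/
structure QCircuit (I : Type) where
  anc : ℕ
  gates : List (QGate (I ⊕ Fin anc))

/-- The number of steps of a circuit: gates plus ancilla initialisations. -/
def QCircuit.size {I : Type} (C : QCircuit I) : ℕ := C.anc + C.gates.length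

/-- The state of the whole register after the circuit has been run on the input state `ρ`. -/
def QCircuit.run {I : Type} [Fintype I] [DecidableEq I] (C : QCircuit I) (ρ : Op I) :
    Op (I ⊕ Fin C.anc) :=
  C.gates.foldl (fun M g => g.op * M * (g.op)ᴴ) (tensor ρ (basisState fun _ => false))

/-- A circuit that outputs a quantum state on the register `O`: after the run all qubits other
than the designated output qubits are discarded. -/
structure QPrep (I O : Type) extends QCircuit I where
  out : O ↪ I ⊕ Fin anc

/-- The state that is output on input `ρ`. -/
def QPrep.output {I O : Type} [Fintype I] [DecidableEq I] [DecidableEq O]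
    (C : QPrep I O) (ρ : Op I) : Op O :=
  reduce C.out (C.toQCircuit.run ρ)

/-- A circuit that outputs one classical bit: after the run one designated qubit is measured. -/
structure QTest (I : Type) extends QCircuit I where
  acc : I ⊕ Fin anc

/-- The probability that the measured bit is `1`. -/
def QTest.prob {I : Type} [Fintype I] [DecidableEq I] (A : QTest I) (ρ : Op I) : ℝ :=
  ∑ s : I ⊕ Fin A.anc → Bool, if s A.acc = true then (A.toQCircuit.run ρ s s).re else 0

/-! ### Asymptotics in the security parameter -/

/-- `f(n) ≤ poly(s(n))`. -/
def PolyIn (s f : ℕ → ℕ) : Prop := ∃ P : Polynomial ℕ, ∀ n, f n ≤ P.eval (s n)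

/-- `μ` is negligible in the security parameter `lam`. -/
def NegligibleIn (lam : ℕ → ℕ) (μ : ℕ → ℝ) : Prop :=
  ∀ d : ℕ, ∃ n₀ : ℕ, ∀ n > n₀, |μ n| < 1 / (lam n : ℝ) ^ d

/-- `f = polylog(n)`. -/
def IsPolylog (f : ℕ → ℕ) : Prop :=
  ∃ a : ℕ, (fun n => (f n : ℝ)) =O[atTop] fun n => Real.log n ^ a

/-! ### Haar random states and the generalized Hilbert-Schmidt ensemble -/

/-- Pure states on the register `Q`: unit vectors. -/
abbrev PureState (Q : Type) [Fintype Q] [DecidableEq Q] : Type :=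
  Metric.sphere (0 : EuclideanSpace ℂ (Q → Bool)) 1

/-- The Haar measure on pure states: the normalised surface measure of the unit sphere. -/
def haarState (Q : Type) [Fintype Q] [DecidableEq Q] : Measure (PureState Q) :=
  (((volume : Measure (EuclideanSpace ℂ (Q → Bool))).toSphere) Set.univ)⁻¹ •
    (volume : Measure (EuclideanSpace ℂ (Q → Bool))).toSphere

/-- `|ψ⟩⟨ψ|`. -/
def proj {Q : Type} [Fintype Q] [DecidableEq Q] (ψ : PureState Q) : Op Q :=
  fun x y => ψ.1 x * star (ψ.1 y)

/-- The GHSE state `tr_m |ψ⟩⟨ψ|` obtained from an `(n + m)`-qubit pure state. -/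
def ghse {n m : ℕ} (ψ : PureState (Fin n ⊕ Fin m)) : Op (Fin n) :=
  reduce Function.Embedding.inl (proj ψ)

/-! ### Verifiable pseudorandom density matrices -/

/-- The average over all keys `k ∈ {0,1}^l`. -/
def keyAvg {E : Type} [AddCommMonoid E] [Module ℝ E] {l : ℕ} (f : (Fin l → Bool) → E) : E :=
  ((2 : ℝ) ^ l)⁻¹ • ∑ k, f k

/-- A keyed family `ρ n k` of `n`-qubit states, `k ∈ {0,1}^{lam n}`, is a VPRDM with mixedness
parameter `m`. -/
structure IsVPRDM (lam m : ℕ → ℕ) (ρ : (n : ℕ) → (Fin (lam n) → Bool) → Op (Fin n)) : Prop where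
  /-- Efficiently preparable: a polynomial-size circuit family maps the key `k` to `ρ n k`. -/
  preparable : ∃ G : (n : ℕ) → QPrep (Fin (lam n)) (Fin n),
    PolyIn lam (fun n => (G n).size) ∧ ∀ n k, (G n).output (basisState k) = ρ n k
  /-- `t = poly(n)` copies are computationally indistinguishable from `t` copies of a state drawn
  from the GHSE. -/
  indist : ∀ t : ℕ → ℕ, PolyIn id t →
    ∀ A : (n : ℕ) → QTest (Fin (t n) × Fin n), PolyIn lam (fun n => (A n).size) →
      NegligibleIn lam fun n =>
        keyAvg (fun k => (A n).prob (tensorPow (t n) (ρ n k))) -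
          ∫ ψ, (A n).prob (tensorPow (t n) (ghse ψ)) ∂(haarState (Fin n ⊕ Fin (m n)))
  /-- Efficient verification: a polynomial-size circuit family accepts the state of key `k` with
  certainty when given `k`, and accepts it with negligible probability when given a random key
  `k' ≠ k`. -/
  verifiable : ∃ V : (n : ℕ) → QTest (Fin n ⊕ Fin (lam n)),
    PolyIn lam (fun n => (V n).size) ∧
    (∀ n k, (V n).prob (tensor (ρ n k) (basisState k)) = 1) ∧
    NegligibleIn lam fun n => keyAvg fun k : Fin (lam n) → Bool =>
      ((2 : ℝ) ^ lam n - 1)⁻¹ *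
        ∑ k' ∈ Finset.univ.erase k, (V n).prob (tensor (ρ n k) (basisState k'))

/-- The state `|0⟩⟨0|^{⊗ (n - m)} ⊗ σ_m` with `σ_m = I / 2^m` (for `m ≤ n`). -/
def tagState (n m : ℕ) : Op (Fin n) :=
  Matrix.diagonal fun x => if ∀ i : Fin n, i.val < n - m → x i = false then ((2 : ℂ) ^ m)⁻¹ else 0

/-- The state `U (|0⟩⟨0|^{⊗ (n - m)} ⊗ σ_m) U†`. -/
def scrambled {n : ℕ} (m : ℕ) (U : Matrix.unitaryGroup (Fin n → Bool) ℂ) : Op (Fin n) :=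
  (U : Op (Fin n)) * tagState n m * (U : Op (Fin n))ᴴ

/-! ### EFI pairs -/

/-- The families `ν₀ n`, `ν₁ n` of `n`-qubit mixed states form an EFI pair with respect to the
security parameter `lam`. -/
structure IsEFI (lam : ℕ → ℕ) (ν : Bool → (n : ℕ) → Op (Fin n)) : Prop where
  /-- Efficient generation. -/
  generation : ∀ b, ∃ G : (n : ℕ) → QPrep Empty (Fin n),
    PolyIn lam (fun n => (G n).size) ∧ ∀ n, (G n).output (basisState Empty.elim) = ν b n
  /-- Statistically far: `‖ν₀ - ν₁‖₁ = Ω(1 / poly(lam))`. -/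
  far : ∃ (d : ℕ) (C : ℝ), 0 < C ∧
    ∀ᶠ n in atTop, C / ((lam n : ℝ) + 1) ^ d ≤ traceNorm (ν false n - ν true n)
  /-- Computationally indistinguishable. -/
  indist : ∀ A : (n : ℕ) → QTest (Fin n), PolyIn lam (fun n => (A n).size) →
    NegligibleIn lam fun n => (A n).prob (ν false n) - (A n).prob (ν true n)

/-! ### Local depolarizing noise -/

/-- Labels of the single-qubit Pauli operators. -/
inductive Pauli where
  | I | X | Y | Z
  deriving DecidableEq

instance : Fintype Pauli where
  elems := {.I, .X, .Y, .Z}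
  complete a := by cases a <;> simp

/-- The Pauli matrices in the basis `|0⟩ = false`, `|1⟩ = true`. -/
def Pauli.mat : Pauli → Matrix Bool Bool ℂ
  | .I => fun a b => if a = b then 1 else 0
  | .X => fun a b => if a = b then 0 else 1
  | .Y => fun a b => if a = b then 0 else if a then Complex.I else -Complex.I
  | .Z => fun a b => if a = b then (if a then -1 else 1) else 0

/-- The distribution `{1 - 3p/4, p/4, p/4, p/4}`, with `Λ_p(ρ) = ∑ α, depolWeight p α • σ^α ρ σ^α`. -/
def depolWeight (p : ℝ) : Pauli → ℝ
  | .I => 1 - 3 * p / 4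
  | _ => p / 4

/-- The Pauli string `⨂ i, σ^{s i}`. -/
def pauliString {n : ℕ} (s : Fin n → Pauli) : Op (Fin n) :=
  fun x y => ∏ i, (s i).mat (x i) (y i)

/-- The `n`-qubit local depolarizing channel `Λ_p^{⊗ n}`, expanded over Pauli strings. -/
def depolarize {n : ℕ} (p : ℝ) (ρ : Op (Fin n)) : Op (Fin n) :=
  ∑ s : Fin n → Pauli, (∏ i, depolWeight p (s i)) • (pauliString s * ρ * (pauliString s)ᴴ)

/-- Shannon entropy in bits. -/
def shannonEntropy {α : Type} [Fintype α] (w : α → ℝ) : ℝ :=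
  ∑ a, Real.negMulLog (w a) / Real.log 2

/-! ### The pairs under consideration -/

/-- Rounding of `c n`, used for the number `lam = c n` of key bits. -/
def keyLen (c : ℝ) (n : ℕ) : ℕ := ⌊c * n⌋₊

/-- Rounding of `γ n`, used for the large mixedness parameter `m₁ = γ n`. -/
def mixLen (γ : ℝ) (n : ℕ) : ℕ := ⌈γ * n⌉₊

/-- Keyed families of `n`-qubit unitaries with keys in `{0,1}^{⌊c n⌋}`. -/
abbrev KeyedUnitaries (c : ℝ) : Type :=
  (n : ℕ) → (Fin (keyLen c n) → Bool) → Matrix.unitaryGroup (Fin n → Bool) ℂ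

/-- The noisy pair: `Λ_p^{⊗ n}` applied to the key averages
`ν₀ = 𝔼_k U⁰_k (|0⟩⟨0|^{⊗ (n - m₀)} ⊗ σ_{m₀}) U⁰_k†` and
`ν₁ = 𝔼_k U¹_k (|0⟩⟨0|^{⊗ (n - m₁)} ⊗ σ_{m₁}) U¹_k†`, with `m₁ = ⌈γ n⌉`. -/
def noisyPair (γ c : ℝ) (m₀ : ℕ → ℕ) (U₀ U₁ : KeyedUnitaries c) (p : ℕ → ℝ) :
    Bool → (n : ℕ) → Op (Fin n)
  | false, n => depolarize (p n) (keyAvg fun k => scrambled (m₀ n) (U₀ n k))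
  | true, n => depolarize (p n) (keyAvg fun k => scrambled (mixLen γ n) (U₁ n k))

/-- The construction of the EFI pair: `0 < c < γ < 1`, `m₀ = polylog(n)`, and the two families
of states are VPRDMs with mixedness parameters `m₀` and `m₁ = ⌈γ n⌉` and keys of
`⌊c n⌋` bits. -/
structure IsEFIConstruction (γ c : ℝ) (m₀ : ℕ → ℕ) (U₀ U₁ : KeyedUnitaries c) : Prop where
  c_pos : 0 < c
  c_lt : c < γ
  lt_one : γ < 1
  m₀_le : ∀ n, m₀ n ≤ n
  m₀_polylog : IsPolylog m₀
  vprdm₀ : IsVPRDM (keyLen c) m₀ fun n k => scrambled (m₀ n) (U₀ n k)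
  vprdm₁ : IsVPRDM (keyLen c) (mixLen γ) fun n k => scrambled (mixLen γ n) (U₁ n k)

end NoisyEFI

end

/-! Two independent facts are combined.

Indistinguishability is a first-moment statement. Invariance of the Haar measure under sign flips
and permutations of coordinates gives the mean of `ghse` as the maximally mixed state, whatever the
mixedness parameter (`integral_ghse`). A test on a single copy is linear in the state, so it cannot
tell two such ensembles apart (`integral_prob_ghse`). Each key average is pseudorandom with `t = 1`,
and the noise is itself a circuit of linear size (`exists_qPrep_depolarize`), so it can be absorbed
into the distinguisher (`indist_noisy`). The same circuit, run after the key-to-state circuit on a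
uniformly random key, gives efficient generation (`exists_generation`).

Statistical distance comes from entropy. The noisy `ν₀` is a mixture of pure states indexed by Pauli
error, key and tag string, with independent weights of total entropy `n H + λ + m₀` bits; its von
Neumann entropy is at most that. The noisy `ν₁` is a mixture of unitary conjugates of a state with
eigenvalues at most `2 ^ (-m₁)`, so its min-entropy is at least `m₁` bits. If the first number is
smaller than the second, `ν₀` must have spectral mass above the threshold `2 ^ (-m₁)`, and
projecting onto it distinguishes the states. `entropy_gap_le_traceNorm` makes this quantitative: the
trace norm is at least the gap divided by a factor linear in `m₁`, hence inverse polynomial.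

For the explicit constants, the entropy is bounded by a line that nearly equals its tangent at `p =
1/4`. At that point the line has value `0.99375`, below `γ - c = 0.9999`, and the remaining room
absorbs every vanishing term. -/

noncomputable section

namespace NoisyEFI

set_option linter.unusedSectionVars false

/-! ### First moments of Haar random states -/

section Haar

variable {E : Type*} [NormedAddCommGroup E] [InnerProductSpace ℝ E]

/-- The action of a linear isometry on the unit sphere. -/
def sphereMap (T : E ≃ₗᵢ[ℝ] E) (v : Metric.sphere (0 : E) 1) : Metric.sphere (0 : E) 1 :=
  ⟨T v.1, by simp⟩

theorem continuous_sphereMap (T : E ≃ₗᵢ[ℝ] E) : Continuous (sphereMap T) :=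
  (T.continuous.comp continuous_subtype_val).subtype_mk _

variable [FiniteDimensional ℝ E] [MeasurableSpace E] [BorelSpace E]

/-- The spherical measure of a set is, up to a constant, the volume of the cone over it inside the
unit ball. A linear isometry carries cones to cones and preserves volume. -/
theorem measurePreserving_sphereMap (T : E ≃ₗᵢ[ℝ] E) :
    MeasurePreserving (sphereMap T) (volume : Measure E).toSphere
      (volume : Measure E).toSphere := by
  refine ⟨(continuous_sphereMap T).measurable, ?_⟩
  ext s hs
  rw [Measure.map_apply (continuous_sphereMap T).measurable hs,
    Measure.toSphere_apply' _ hs,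
    Measure.toSphere_apply' _ ((continuous_sphereMap T).measurable hs)]
  congr 1
  have hT : MeasurePreserving T.toHomeomorph.toMeasurableEquiv (volume : Measure E) volume :=
    T.measurePreserving
  refine Eq.trans ?_ (hT.measure_preimage_equiv _)
  congr 1
  ext v
  simp only [Set.mem_smul, Set.mem_image, Set.mem_preimage, Subtype.exists]
  constructor
  · rintro ⟨r, hr, w, ⟨u, hu, hus, rfl⟩, rfl⟩
    exact ⟨r, hr, T u, ⟨T u, by simpa using hu, hus, rfl⟩, (map_smul T r u).symm⟩
  · rintro ⟨r, hr, w, ⟨u, hu, hus, rfl⟩, h⟩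
    refine ⟨r, hr, T.symm u, ⟨T.symm u, by simpa using hu, ?_, rfl⟩, ?_⟩
    · simpa [sphereMap] using hus
    · apply T.injective
      rw [map_smul, T.apply_symm_apply]
      exact h

end Haar

variable {Q : Type} [Fintype Q] [DecidableEq Q]

instance : IsProbabilityMeasure (haarState Q) := by
  constructor
  rw [haarState, Measure.smul_apply, smul_eq_mul]
  refine ENNReal.inv_mul_cancel ?_ (measure_ne_top _ _)
  rw [Ne, Measure.measure_univ_eq_zero]
  exact Measure.toSphere_ne_zero _

theorem measurePreserving_haarState
    (T : EuclideanSpace ℂ (Q → Bool) ≃ₗᵢ[ℝ] EuclideanSpace ℂ (Q → Bool)) :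
    MeasurePreserving (sphereMap T) (haarState Q) (haarState Q) :=
  (measurePreserving_sphereMap T).smul_measure _

theorem integral_haarState_comp
    (T : EuclideanSpace ℂ (Q → Bool) ≃ₗᵢ[ℝ] EuclideanSpace ℂ (Q → Bool))
    {f : PureState Q → ℂ} (hf : Continuous f) :
    ∫ ψ, f (sphereMap T ψ) ∂haarState Q = ∫ ψ, f ψ ∂haarState Q := by
  rw [← (measurePreserving_haarState T).map_eq,
    integral_map (continuous_sphereMap T).aemeasurable hf.aestronglyMeasurable,
    (measurePreserving_haarState T).map_eq]

theorem continuous_proj_apply (x y : Q → Bool) : Continuous fun ψ : PureState Q => proj ψ x y := by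
  unfold proj
  fun_prop

theorem integrable_proj_apply (x y : Q → Bool) :
    Integrable (fun ψ : PureState Q => proj ψ x y) (haarState Q) :=
  (continuous_proj_apply x y).integrable_of_hasCompactSupport (HasCompactSupport.of_compactSpace _)

/-- Flipping the sign of the coordinate `x` preserves the measure and negates the integrand. -/
theorem integral_proj_of_ne {x y : Q → Bool} (hxy : x ≠ y) :
    ∫ ψ, proj ψ x y ∂haarState Q = 0 := by
  let T : EuclideanSpace ℂ (Q → Bool) ≃ₗᵢ[ℝ] EuclideanSpace ℂ (Q → Bool) :=
    LinearIsometryEquiv.piLpCongrRight 2 fun z =>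
      if z = x then LinearIsometryEquiv.neg ℝ else LinearIsometryEquiv.refl ℝ ℂ
  have h := integral_haarState_comp T (continuous_proj_apply x y)
  have h2 : ∀ ψ, proj (sphereMap T ψ) x y = - proj ψ x y := by
    intro ψ
    simp [proj, sphereMap, T, hxy.symm]
  simp only [h2, integral_neg] at h
  exact self_eq_neg.mp h.symm

/-- Swapping coordinates shows that all diagonal moments agree, and normalisation of the vector
makes them sum to one. -/
theorem integral_proj_diag (x : Q → Bool) :
    ∫ ψ, proj ψ x x ∂haarState Q = ((2 : ℂ) ^ Fintype.card Q)⁻¹ := by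
  have h1 : ∀ y, ∫ ψ, proj ψ y y ∂haarState Q = ∫ ψ, proj ψ x x ∂haarState Q := by
    intro y
    let T : EuclideanSpace ℂ (Q → Bool) ≃ₗᵢ[ℝ] EuclideanSpace ℂ (Q → Bool) :=
      LinearIsometryEquiv.piLpCongrLeft 2 ℝ ℂ (Equiv.swap x y)
    rw [← integral_haarState_comp T (continuous_proj_apply y y)]
    congr 1
    ext ψ
    simp [proj, sphereMap, T]
  have h2 : ∑ y, ∫ ψ, proj ψ y y ∂haarState Q = 1 := by
    rw [← integral_finsetSum _ fun y _ => integrable_proj_apply y y]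
    have : ∀ ψ : PureState Q, ∑ y, proj ψ y y = 1 := by
      intro ψ
      have h := ψ.2
      rw [mem_sphere_zero_iff_norm, EuclideanSpace.norm_eq, Real.sqrt_eq_one] at h
      rw [← Complex.ofReal_one, ← h]
      push_cast
      refine Finset.sum_congr rfl fun y _ => ?_
      simp [proj, Complex.mul_conj, Complex.normSq_eq_norm_sq]
    simp [this]
  simp only [h1, Finset.sum_const, Finset.card_univ, Fintype.card_fun, Fintype.card_bool,
    nsmul_eq_mul] at h2
  push_cast at h2
  exact eq_inv_of_mul_eq_one_right h2

theorem integral_proj (x y : Q → Bool) :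
    ∫ ψ, proj ψ x y ∂haarState Q = if x = y then ((2 : ℂ) ^ Fintype.card Q)⁻¹ else 0 := by
  split_ifs with h
  · rw [h, integral_proj_diag]
  · exact integral_proj_of_ne h

/-! ### A lower bound on the trace distance from an entropy gap -/

section TraceNorm

variable {ι : Type} [Fintype ι]

theorem sum_normSq_eq_conjTranspose_mul_self (M : Matrix ι ι ℂ) (i : ι) :
    ((∑ k, Complex.normSq (M k i) : ℝ) : ℂ) = (Mᴴ * M) i i := by
  simp [Matrix.mul_apply, Complex.normSq_eq_conj_mul_self]

variable [DecidableEq ι]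

theorem conjTranspose_eigenvectorUnitary_mul_mul {A : Matrix ι ι ℂ} (hA : A.IsHermitian) :
    (hA.eigenvectorUnitary : Matrix ι ι ℂ)ᴴ * A * (hA.eigenvectorUnitary : Matrix ι ι ℂ) =
      Matrix.diagonal fun i => (hA.eigenvalues i : ℂ) := by
  have h := hA.conjStarAlgAut_star_eigenvectorUnitary
  rw [Unitary.conjStarAlgAut_apply] at h
  simpa [Matrix.star_eq_conjTranspose, Function.comp_def] using h

theorem sum_normSq_mulVec {M : Matrix ι ι ℂ} (hM : Mᴴ * M = 1) (w : ι → ℂ) :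
    ∑ i, Complex.normSq ((M *ᵥ w) i) = ∑ i, Complex.normSq (w i) := by
  have h1 : ∀ z : ι → ℂ, ((∑ i, Complex.normSq (z i) : ℝ) : ℂ) = star z ⬝ᵥ z := by
    intro z
    simp [dotProduct, Complex.normSq_eq_conj_mul_self]
  have h2 : ((∑ i, Complex.normSq ((M *ᵥ w) i) : ℝ) : ℂ) = (∑ i, Complex.normSq (w i) : ℝ) := by
    rw [h1, h1, Matrix.star_mulVec, Matrix.dotProduct_mulVec, Matrix.vecMul_vecMul, hM,
      Matrix.vecMul_one]
  exact_mod_cast h2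

/-- All eigenvalues of `M` are at most `μ`. -/
def SpectrumLE (M : Matrix ι ι ℂ) (μ : ℝ) : Prop :=
  ∀ w : ι → ℂ, (star w ⬝ᵥ (M *ᵥ w)).re ≤ μ * ∑ i, Complex.normSq (w i)

/-- Half of the duality between the trace norm and the operator norm. -/
theorem re_trace_mul_le_traceNorm (P X : Matrix ι ι ℂ)
    (hP : ∀ v : ι → ℂ, ∑ k, Complex.normSq ((Pᴴ *ᵥ v) k) ≤ ∑ k, Complex.normSq (v k)) :
    (P * X).trace.re ≤ traceNorm X := by
  have hX := Matrix.isHermitian_conjTranspose_mul_self X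
  set U : Matrix ι ι ℂ := (hX.eigenvectorUnitary : Matrix ι ι ℂ) with hU
  have hUU : U * Uᴴ = 1 := Matrix.mem_unitaryGroup_iff.mp hX.eigenvectorUnitary.2
  have hUU' : Uᴴ * U = 1 := Matrix.mem_unitaryGroup_iff'.mp hX.eigenvectorUnitary.2
  have htr : (P * X).trace = ∑ i, ((Pᴴ * U)ᴴ * (X * U)) i i := by
    change _ = Matrix.trace _
    rw [Matrix.conjTranspose_mul, Matrix.conjTranspose_conjTranspose, Matrix.mul_assoc,
      ← Matrix.mul_assoc P, Matrix.trace_mul_comm Uᴴ, Matrix.mul_assoc, Matrix.mul_assoc,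
      hUU, Matrix.mul_one]
  have hdiag := conjTranspose_eigenvectorUnitary_mul_mul hX
  rw [← hU] at hdiag
  -- The columns of `X * U` have the singular values of `X` as lengths, and those of `Pᴴ * U` have
  -- length at most one. Cauchy–Schwarz for each column then gives the bound.
  have hev : ∀ i, hX.eigenvalues i = ∑ k, Complex.normSq ((X * U) k i) := by
    intro i
    have h := sum_normSq_eq_conjTranspose_mul_self (X * U) i
    rw [Matrix.conjTranspose_mul, Matrix.mul_assoc, ← Matrix.mul_assoc Xᴴ,
      ← Matrix.mul_assoc, hdiag, Matrix.diagonal_apply_eq] at h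
    exact_mod_cast h.symm
  have hPU : ∀ i, ∑ k, Complex.normSq ((Pᴴ * U) k i) ≤ 1 := by
    intro i
    refine (hP fun k => U k i).trans_eq ?_
    have h := sum_normSq_eq_conjTranspose_mul_self U i
    rw [hUU', Matrix.one_apply_eq] at h
    exact_mod_cast h
  rw [htr, Complex.re_sum, traceNorm]
  refine Finset.sum_le_sum fun i _ => ?_
  rw [hev]
  calc ((((Pᴴ * U)ᴴ * (X * U)) i i).re)
      ≤ ‖∑ k, star ((Pᴴ * U) k i) * (X * U) k i‖ := Complex.re_le_norm _
    _ ≤ ∑ k, ‖(Pᴴ * U) k i‖ * ‖(X * U) k i‖ := by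
        refine (norm_sum_le _ _).trans_eq ?_
        simp
    _ ≤ √(∑ k, ‖(Pᴴ * U) k i‖ ^ 2) * √(∑ k, ‖(X * U) k i‖ ^ 2) :=
        Real.sum_mul_le_sqrt_mul_sqrt _ _ _
    _ ≤ 1 * √(∑ k, Complex.normSq ((X * U) k i)) := by
        simp only [← Complex.normSq_eq_norm_sq]
        refine mul_le_mul_of_nonneg_right ?_ (Real.sqrt_nonneg _)
        exact Real.sqrt_le_one.mpr (hPU i)
    _ = _ := one_mul _

end TraceNorm

/-- Coordinates with respect to an eigenbasis of a mixture decrease the entropy. -/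
theorem sum_mul_log_le_of_diagonal {ι J : Type} [Fintype ι] [DecidableEq ι] [Fintype J]
    (q : J → ℝ) (hq : ∀ j, 0 ≤ q j) (hq1 : ∑ j, q j = 1)
    (u : J → ι → ℂ) (hu : ∀ j, ∑ i, Complex.normSq (u j i) = 1) (a : ι → ℝ)
    (ha : ∀ i i', ∑ j, (q j : ℂ) * (u j i * star (u j i')) = if i = i' then (a i : ℂ) else 0) :
    ∑ j, q j * Real.log (q j) ≤ ∑ i, a i * Real.log (a i) := by
  have hdiag : ∀ i, a i = ∑ j, q j * Complex.normSq (u j i) := by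
    intro i
    have h := ha i i
    simp only [Complex.star_def, Complex.mul_conj, if_true] at h
    exact_mod_cast h.symm
  have ha0 : ∀ i, 0 ≤ a i := fun i => by
    rw [hdiag]
    exact Finset.sum_nonneg fun j _ => mul_nonneg (hq j) (Complex.normSq_nonneg _)
  -- The quadratic form of the pseudo-inverse of `diagonal a` at `u j`: division by zero drops the
  -- kernel coordinates.
  set s : J → ℝ := fun j => ∑ i, Complex.normSq (u j i) / a i with hs
  have hs0 : ∀ j, 0 ≤ s j := fun j =>
    Finset.sum_nonneg fun i _ => div_nonneg (Complex.normSq_nonneg _) (ha0 i)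
  -- The mixture dominates its `j`-th summand as a quadratic form. Evaluating both at `y`, the
  -- pseudo-inverse applied to `u j`, gives `q j * s j ^ 2 ≤ s j`.
  have hqs : ∀ j, q j * s j ≤ 1 := by
    intro j
    have key : q j * s j ^ 2 ≤ s j := by
      let y : ι → ℂ := fun i => u j i / a i
      have h1 : ∑ k, q k * Complex.normSq (∑ i, star (y i) * u k i) = s j := by
        have : ∑ k, (q k : ℂ) * ((∑ i, star (y i) * u k i) * star (∑ i, star (y i) * u k i))
            = ∑ i, ∑ i', star (y i) * y i' * ∑ k, (q k : ℂ) * (u k i * star (u k i')) := by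
          simp only [star_sum, Finset.sum_mul_sum]
          simp only [Finset.mul_sum]
          rw [Finset.sum_comm]
          refine Finset.sum_congr rfl fun i _ => ?_
          rw [Finset.sum_comm]
          refine Finset.sum_congr rfl fun i' _ => Finset.sum_congr rfl fun k _ => ?_
          simp only [star_mul', star_star]
          ring
        simp only [ha, mul_ite, mul_zero, Finset.sum_ite_eq, Finset.mem_univ, if_true] at this
        have h2 : ∀ i, (starRingEnd ℂ) (y i) * y i * (a i : ℂ) = ((Complex.normSq (u j i) / a i : ℝ) : ℂ) := by
          intro i
          rcases eq_or_ne (a i) 0 with h0 | h0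
          · simp [h0]
          · have h0' : (a i : ℂ) ≠ 0 := by exact_mod_cast h0
            simp only [y, map_div₀, Complex.conj_ofReal]
            push_cast
            rw [Complex.normSq_eq_conj_mul_self]
            field_simp
        simp only [h2, Complex.star_def, Complex.mul_conj] at this
        rw [hs]
        exact_mod_cast this
      have h2 : ∑ i, star (y i) * u j i = (s j : ℂ) := by
        rw [hs]
        push_cast
        refine Finset.sum_congr rfl fun i _ => ?_
        simp only [y, ← starRingEnd_apply, map_div₀, Complex.conj_ofReal]
        rw [Complex.normSq_eq_conj_mul_self]
        ring
      calc q j * s j ^ 2 = q j * Complex.normSq (∑ i, star (y i) * u j i) := by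
            rw [h2, Complex.normSq_ofReal]; ring
        _ ≤ ∑ k, q k * Complex.normSq (∑ i, star (y i) * u k i) :=
            Finset.single_le_sum (f := fun k => q k * Complex.normSq (∑ i, star (y i) * u k i))
              (fun k _ => mul_nonneg (hq k) (Complex.normSq_nonneg _)) (Finset.mem_univ j)
        _ = s j := h1
    rcases (hs0 j).eq_or_lt with h0 | h0
    · rw [← h0]; simp
    · exact le_of_mul_le_mul_right (by nlinarith) h0
  -- This is `log (q j / a i) ≤ q j / a i - 1` weighted by `q j * |u j i|²`. These weights form a
  -- joint distribution with marginals `a` and `q`, so the double sum gives the two entropies, and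
  -- `hqs` controls the ratio term.
  have hterm : ∀ i j, q j * Complex.normSq (u j i) - q j * (q j * (Complex.normSq (u j i) / a i))
      ≤ q j * Complex.normSq (u j i) * Real.log (a i)
        - q j * Complex.normSq (u j i) * Real.log (q j) := by
    intro i j
    rcases (mul_nonneg (hq j) (Complex.normSq_nonneg (u j i))).eq_or_lt with h0 | h0
    · have : q j * (q j * (Complex.normSq (u j i) / a i))
          = q j * Complex.normSq (u j i) * (q j / a i) := by ring
      rw [this, ← h0]; simp
    · have hqj : 0 < q j := (hq j).lt_of_ne' fun h => by simp [h] at h0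
      have hai : 0 < a i := h0.trans_le <| by
        rw [hdiag]
        exact Finset.single_le_sum (f := fun k => q k * Complex.normSq (u k i))
              (fun k _ => mul_nonneg (hq k) (Complex.normSq_nonneg _)) (Finset.mem_univ j)
      have hlog := Real.log_le_sub_one_of_pos (div_pos hqj hai)
      rw [Real.log_div hqj.ne' hai.ne'] at hlog
      have := mul_le_mul_of_nonneg_left hlog h0.le
      have e : q j * (q j * (Complex.normSq (u j i) / a i))
          = q j * Complex.normSq (u j i) * (q j / a i) := by ring
      rw [e]
      linarith
  have hsum := Finset.sum_le_sum fun i (_ : i ∈ Finset.univ) =>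
    Finset.sum_le_sum fun j (_ : j ∈ Finset.univ) => hterm i j
  simp only [Finset.sum_sub_distrib, ← Finset.sum_mul, ← hdiag] at hsum
  have e1 : ∑ i, a i = 1 := by
    simp only [hdiag]
    rw [Finset.sum_comm]
    simp only [← Finset.mul_sum, hu, mul_one, hq1]
  have e2 : ∑ i, ∑ j, q j * (q j * (Complex.normSq (u j i) / a i)) ≤ 1 := by
    rw [Finset.sum_comm]
    simp only [← Finset.mul_sum]
    calc ∑ j, q j * (q j * s j) ≤ ∑ j, q j * 1 :=
          Finset.sum_le_sum fun j _ => mul_le_mul_of_nonneg_left (hqs j) (hq j)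
      _ = 1 := by simp [hq1]
  have e3 : ∑ i, ∑ j, q j * Complex.normSq (u j i) * Real.log (q j)
      = ∑ j, q j * Real.log (q j) := by
    rw [Finset.sum_comm]
    refine Finset.sum_congr rfl fun j _ => ?_
    rw [← Finset.sum_mul, ← Finset.mul_sum, hu, mul_one]
  rw [e1, e3] at hsum
  linarith

/-- Converts a pointwise entropy excess into mass above the threshold `μ`. For `a > μ`, split `a = μ
+ (a - μ)` in front of `log (a / μ)`: the first part is at most `a - μ`, and in the second `log a ≤
0`. -/
theorem mul_log_le_mul_posPart {a μ : ℝ} (ha0 : 0 ≤ a) (ha1 : a ≤ 1) (hμ : 0 < μ) :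
    a * Real.log a - a * Real.log μ ≤ (1 - Real.log μ) * max (a - μ) 0 := by
  rcases le_or_gt a μ with h | h
  · rw [max_eq_right (by linarith), mul_zero]
    rcases ha0.eq_or_lt with h0 | h0
    · simp [← h0]
    · have := Real.log_le_log h0 h
      nlinarith
  · rw [max_eq_left (by linarith)]
    have ha : 0 < a := hμ.trans h
    have h1 := Real.log_le_sub_one_of_pos (div_pos ha hμ)
    rw [Real.log_div ha.ne' hμ.ne'] at h1
    have h2 := Real.log_nonpos ha0 ha1
    have h3 : μ * (Real.log a - Real.log μ) ≤ a - μ := by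
      calc _ ≤ μ * (a / μ - 1) := mul_le_mul_of_nonneg_left h1 hμ.le
        _ = a - μ := by field_simp
    nlinarith [mul_nonneg (sub_nonneg.mpr h.le) (neg_nonneg.mpr h2)]

/-- If `A` is a mixture of pure states with weights `q` and `B ≤ μ`, the trace distance of `A` and
`B` is bounded below by the gap between the entropy of `q` and the min-entropy of `B`. -/
theorem entropy_gap_le_traceNorm {ι J : Type} [Fintype ι] [DecidableEq ι] [Fintype J]
    (q : J → ℝ) (hq : ∀ j, 0 ≤ q j) (hq1 : ∑ j, q j = 1)
    (v : J → ι → ℂ) (hv : ∀ j, ∑ i, Complex.normSq (v j i) = 1) (A B : Matrix ι ι ℂ)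
    (hA : A = ∑ j, (q j : ℂ) • Matrix.vecMulVec (v j) (star (v j))) {μ : ℝ} (hμ : 0 < μ)
    (hμ1 : μ ≤ 1)
    (hB : SpectrumLE B μ) :
    ∑ j, q j * Real.log (q j) - Real.log μ ≤ (1 - Real.log μ) * traceNorm (A - B) := by
  have hAh : A.IsHermitian := by
    rw [hA, Matrix.IsHermitian, Matrix.conjTranspose_sum]
    simp [Matrix.conjTranspose_vecMulVec]
  set U : Matrix ι ι ℂ := (hAh.eigenvectorUnitary : Matrix ι ι ℂ) with hU
  have hUU : U * Uᴴ = 1 := Matrix.mem_unitaryGroup_iff.mp hAh.eigenvectorUnitary.2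
  have hUU' : Uᴴ * U = 1 := Matrix.mem_unitaryGroup_iff'.mp hAh.eigenvectorUnitary.2
  have hdiag := conjTranspose_eigenvectorUnitary_mul_mul hAh
  rw [← hU] at hdiag
  set a := hAh.eigenvalues with ha
  have hentry : ∀ i i', ∑ j, (q j : ℂ) * ((Uᴴ *ᵥ v j) i * star ((Uᴴ *ᵥ v j) i'))
      = if i = i' then (a i : ℂ) else 0 := by
    intro i i'
    have h := congrFun (congrFun hdiag i) i'
    rw [Matrix.diagonal_apply, hA, Matrix.mul_sum, Matrix.sum_mul, Matrix.sum_apply] at h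
    rw [← h]
    refine Finset.sum_congr rfl fun j _ => ?_
    rw [Matrix.mul_smul, Matrix.smul_mul, Matrix.smul_apply, smul_eq_mul,
      Matrix.mul_vecMulVec, Matrix.vecMulVec_mul, Matrix.vecMulVec_apply]
    congr 2
    rw [← Pi.star_apply, Matrix.star_mulVec, Matrix.conjTranspose_conjTranspose]
  have hu : ∀ j, ∑ i, Complex.normSq ((Uᴴ *ᵥ v j) i) = 1 := fun j => by
    rw [sum_normSq_mulVec (by rwa [Matrix.conjTranspose_conjTranspose]), hv]
  have hent := sum_mul_log_le_of_diagonal q hq hq1 _ hu a hentry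
  have hdiag' : ∀ i, a i = ∑ j, q j * Complex.normSq ((Uᴴ *ᵥ v j) i) := by
    intro i
    have h := hentry i i
    simp only [Complex.star_def, Complex.mul_conj, if_true] at h
    exact_mod_cast h.symm
  have ha0 : ∀ i, 0 ≤ a i := fun i => by
    rw [hdiag']
    exact Finset.sum_nonneg fun j _ => mul_nonneg (hq j) (Complex.normSq_nonneg _)
  have hasum : ∑ i, a i = 1 := by
    simp only [hdiag']
    rw [Finset.sum_comm]
    simp only [← Finset.mul_sum, hu, mul_one, hq1]
  have ha1 : ∀ i, a i ≤ 1 := fun i => by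
    rw [← hasum]
    exact Finset.single_le_sum (fun k _ => ha0 k) (Finset.mem_univ i)
  -- `U * D * Uᴴ` is the spectral projection of `A` onto eigenvalues above `μ`; it is the test that
  -- separates `A` from `B`.
  let D : Matrix ι ι ℂ := Matrix.diagonal fun i => if μ < a i then 1 else 0
  have hD : Dᴴ = D := by
    simp only [D, Matrix.diagonal_conjTranspose]
    congr 1
    ext i
    simp only [Pi.star_apply]
    split_ifs <;> simp
  have hPc : ∀ w : ι → ℂ,
      ∑ k, Complex.normSq (((U * D * Uᴴ)ᴴ *ᵥ w) k) ≤ ∑ k, Complex.normSq (w k) := by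
    intro w
    rw [Matrix.conjTranspose_mul, Matrix.conjTranspose_mul, Matrix.conjTranspose_conjTranspose,
      hD, ← Matrix.mulVec_mulVec, sum_normSq_mulVec hUU', ← Matrix.mulVec_mulVec,
      ← sum_normSq_mulVec (M := Uᴴ) (by rwa [Matrix.conjTranspose_conjTranspose]) w]
    refine Finset.sum_le_sum fun k _ => ?_
    rw [Matrix.mulVec_diagonal]
    split_ifs
    · simp
    · simpa using Complex.normSq_nonneg _
  have htr := re_trace_mul_le_traceNorm _ (A - B) hPc
  -- On each eigenvector kept by `D`, `A` contributes `a i` and `B` at most `μ`.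
  have hlow : ∑ i, max (a i - μ) 0 ≤ ((U * D * Uᴴ) * (A - B)).trace.re := by
    have e : ((U * D * Uᴴ) * (A - B)).trace = (D * (Uᴴ * A * U - Uᴴ * B * U)).trace := by
      rw [← Matrix.sub_mul, ← Matrix.mul_sub, Matrix.mul_assoc, Matrix.mul_assoc,
        Matrix.trace_mul_comm]
      simp only [Matrix.mul_assoc]
    rw [e, hdiag, Matrix.trace, Complex.re_sum]
    refine Finset.sum_le_sum fun i _ => ?_
    rw [Matrix.diag_apply, Matrix.diagonal_mul, Matrix.sub_apply, Matrix.diagonal_apply_eq]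
    have hBi := hB fun k => U k i
    have hUi : ∑ k, Complex.normSq (U k i) = 1 := by
      have h := sum_normSq_eq_conjTranspose_mul_self U i
      rw [hUU', Matrix.one_apply_eq] at h
      exact_mod_cast h
    have hBe : (Uᴴ * B * U) i i = star (fun k => U k i) ⬝ᵥ (B *ᵥ fun k => U k i) := by
      rw [Matrix.mul_assoc, Matrix.mul_apply]
      rfl
    rw [hUi, mul_one, ← hBe] at hBi
    split_ifs with h
    · rw [one_mul, max_eq_left (by linarith), Complex.sub_re, Complex.ofReal_re]
      linarith
    · rw [zero_mul, max_eq_right (by linarith), Complex.zero_re]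
  have hlogμ : Real.log μ ≤ 0 := Real.log_nonpos hμ.le hμ1
  calc ∑ j, q j * Real.log (q j) - Real.log μ
      ≤ ∑ i, a i * Real.log (a i) - ∑ i, a i * Real.log μ := by
        rw [← Finset.sum_mul, hasum, one_mul]; linarith
    _ ≤ ∑ i, (1 - Real.log μ) * max (a i - μ) 0 := by
        rw [← Finset.sum_sub_distrib]
        exact Finset.sum_le_sum fun i _ => mul_log_le_mul_posPart (ha0 i) (ha1 i) hμ
    _ = (1 - Real.log μ) * ∑ i, max (a i - μ) 0 := by rw [Finset.mul_sum]
    _ ≤ _ := mul_le_mul_of_nonneg_left (hlow.trans htr) (by linarith)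

/-! ### Partial traces and local operators -/

section Reduce

variable {O O' R Q Q' : Type} [Fintype O] [DecidableEq O] [Fintype R] [DecidableEq R]
  [Fintype Q] [DecidableEq Q] [Fintype O'] [DecidableEq O'] [Fintype Q'] [DecidableEq Q']

/-- Bit strings on a register that is split into two parts. -/
def splitEquiv (φ : O ⊕ R ≃ Q) : (O → Bool) × (R → Bool) ≃ (Q → Bool) :=
  (Equiv.sumArrowEquivProdArrow O R Bool).symm.trans (φ.arrowCongr (Equiv.refl Bool))

theorem splitEquiv_apply (φ : O ⊕ R ≃ Q) (x : O → Bool) (r : R → Bool) :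
    splitEquiv φ (x, r) = Sum.elim x r ∘ φ.symm := rfl

@[simp] theorem splitEquiv_inl (φ : O ⊕ R ≃ Q) (p : (O → Bool) × (R → Bool)) (i : O) :
    splitEquiv φ p (φ (Sum.inl i)) = p.1 i := by
  obtain ⟨x, r⟩ := p
  simp [splitEquiv_apply]

@[simp] theorem splitEquiv_inr (φ : O ⊕ R ≃ Q) (p : (O → Bool) × (R → Bool)) (i : R) :
    splitEquiv φ p (φ (Sum.inr i)) = p.2 i := by
  obtain ⟨x, r⟩ := p
  simp [splitEquiv_apply]

/-- The embedding of the first part of a split register. -/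
def leftPart (φ : O ⊕ R ≃ Q) : O ↪ Q := Function.Embedding.inl.trans φ.toEmbedding

theorem leftPart_apply (φ : O ⊕ R ≃ Q) (i : O) : leftPart φ i = φ (Sum.inl i) := rfl

theorem forall_notMem_range_leftPart (φ : O ⊕ R ≃ Q) (P : Q → Prop) :
    (∀ q, q ∉ Set.range (leftPart φ) → P q) ↔ ∀ r, P (φ (Sum.inr r)) := by
  constructor
  · intro h r
    refine h _ ?_
    rintro ⟨i, hi⟩
    have := φ.injective hi
    simp at this
  · intro h q hq
    obtain ⟨z, rfl⟩ := φ.surjective q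
    rcases z with i | r
    · exact absurd ⟨i, rfl⟩ hq
    · exact h r

/-- With the complement of the range as an explicit register, partial traces become single sums over
its strings. Most facts about `reduce` below start from this. -/
theorem exists_eq_leftPart (e : O ↪ Q) :
    ∃ (R : Type) (_ : Fintype R) (_ : DecidableEq R) (φ : O ⊕ R ≃ Q), e = leftPart φ := by
  classical
  refine ⟨{q // q ∉ Set.range e}, inferInstance, inferInstance,
    ((Equiv.ofInjective e e.injective).sumCongr (Equiv.refl _)).trans
      (Equiv.Set.sumCompl (Set.range e)), ?_⟩
  ext i
  rfl

theorem reduce_leftPart (φ : O ⊕ R ≃ Q) (M : Op Q) (x y : O → Bool) :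
    reduce (leftPart φ) M x y = ∑ r, M (splitEquiv φ (x, r)) (splitEquiv φ (y, r)) := by
  classical
  have h1 : ∀ p : (O → Bool) × (R → Bool), (splitEquiv φ p) ∘ leftPart φ = p.1 := by
    intro p
    ext i
    simp [leftPart_apply]
  have h2 : ∀ p p' : (O → Bool) × (R → Bool),
      (∀ q, q ∉ Set.range (leftPart φ) → splitEquiv φ p q = splitEquiv φ p' q) ↔ p.2 = p'.2 := by
    intro p p'
    rw [forall_notMem_range_leftPart]
    simp [funext_iff]
  have key : reduce (leftPart φ) M x y = ∑ p, ∑ p',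
      if p.1 = x ∧ p'.1 = y ∧ p.2 = p'.2 then M (splitEquiv φ p) (splitEquiv φ p') else 0 := by
    unfold reduce
    refine (Fintype.sum_equiv (splitEquiv φ) _ _ fun p => ?_).symm
    refine Fintype.sum_equiv (splitEquiv φ) _ _ fun p' => ?_
    simp only [h1, h2]
  rw [key, Fintype.sum_prod_type, Finset.sum_eq_single x (fun b _ hb => by simp [hb]) (by simp)]
  refine Finset.sum_congr rfl fun r _ => ?_
  rw [Fintype.sum_prod_type, Finset.sum_eq_single y (fun b _ hb => by simp [hb]) (by simp)]
  simp

theorem mul_splitEquiv (φ : O ⊕ R ≃ Q) (A B : Op Q) (s s' : Q → Bool) :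
    (A * B) s s' = ∑ a, ∑ r, A s (splitEquiv φ (a, r)) * B (splitEquiv φ (a, r)) s' := by
  rw [Matrix.mul_apply, ← Fintype.sum_prod_type']
  exact (Fintype.sum_equiv (splitEquiv φ) _ _ fun p => rfl).symm

/-- The operator `N` on the qubits selected by `e`, tensored with the identity. -/
def liftOp (e : O ↪ Q) (N : Op O) : Op Q := by
  classical
  exact fun s s' => if ∀ q, q ∉ Set.range e → s q = s' q then N (s ∘ e) (s' ∘ e) else 0

theorem liftOp_leftPart (φ : O ⊕ R ≃ Q) (N : Op O) (p p' : (O → Bool) × (R → Bool)) :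
    liftOp (leftPart φ) N (splitEquiv φ p) (splitEquiv φ p')
      = if p.2 = p'.2 then N p.1 p'.1 else 0 := by
  have h1 : ∀ p : (O → Bool) × (R → Bool), (splitEquiv φ p) ∘ leftPart φ = p.1 := by
    intro p
    ext i
    simp [leftPart_apply]
  simp only [liftOp, forall_notMem_range_leftPart, h1, splitEquiv_inr, funext_iff]

/-- The lifted operator is block diagonal in the string on the discarded qubits, with the same block
`N` each time, so it passes through the sum over that string. -/
theorem reduce_liftOp (e : O ↪ Q) (N : Op O) (M : Op Q) :
    reduce e (liftOp e N * M * (liftOp e N)ᴴ) = N * reduce e M * Nᴴ := by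
  obtain ⟨R, _, _, φ, rfl⟩ := exists_eq_leftPart e
  ext x y
  simp only [reduce_leftPart, mul_splitEquiv φ, Matrix.conjTranspose_apply, liftOp_leftPart,
    ite_mul, zero_mul, Finset.sum_ite_eq, Finset.mem_univ, if_true, apply_ite star, star_zero,
    mul_ite, mul_zero]
  simp only [Matrix.mul_apply, reduce_leftPart, Matrix.conjTranspose_apply, Finset.sum_mul,
    Finset.mul_sum]
  rw [Finset.sum_comm]
  refine Finset.sum_congr rfl fun b _ => ?_
  rw [Finset.sum_comm]

theorem reduce_trans (f : O' ↪ O) (e : O ↪ Q) (M : Op Q) :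
    reduce (f.trans e) M = reduce f (reduce e M) := by
  obtain ⟨R, _, _, φ, rfl⟩ := exists_eq_leftPart e
  obtain ⟨R', _, _, ψ, rfl⟩ := exists_eq_leftPart f
  let χ : O' ⊕ (R' ⊕ R) ≃ Q :=
    ((Equiv.sumAssoc O' R' R).symm.trans (ψ.sumCongr (Equiv.refl R))).trans φ
  have hχ : (leftPart ψ).trans (leftPart φ) = leftPart χ := rfl
  ext x y
  rw [hχ]
  simp only [reduce_leftPart]
  have hs : ∀ (z : O' → Bool) (p : (R' → Bool) × (R → Bool)),
      splitEquiv χ (z, splitEquiv (Equiv.refl _) p) = splitEquiv φ (splitEquiv ψ (z, p.1), p.2) := by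
    rintro z ⟨r', r⟩
    ext q
    obtain ⟨t, rfl⟩ := φ.surjective q
    rcases t with i | r
    · obtain ⟨t, rfl⟩ := ψ.surjective i
      rcases t with i | r
      · simp [splitEquiv_apply, χ]
      · simp [splitEquiv_apply, χ]
    · simp [splitEquiv_apply, χ]
  rw [← Equiv.sum_comp (splitEquiv (Equiv.refl (R' ⊕ R)))]
  simp only [hs, Fintype.sum_prod_type]

theorem reduce_equiv (φ : O ≃ Q) (M : Op Q) (x y : O → Bool) :
    reduce φ.toEmbedding M x y = M (x ∘ φ.symm) (y ∘ φ.symm) := by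
  have h : φ.toEmbedding = leftPart ((Equiv.sumEmpty O Empty).trans φ) := rfl
  rw [h, reduce_leftPart]
  have h2 : ∀ (z : O → Bool) (r : Empty → Bool),
      splitEquiv ((Equiv.sumEmpty O Empty).trans φ) (z, r) = z ∘ φ.symm := by
    intro z r
    ext q
    simp [splitEquiv_apply]
  simp [h2]

theorem reduce_refl (M : Op Q) : reduce (Function.Embedding.refl Q) M = M := by
  ext x y
  exact reduce_equiv (Equiv.refl Q) M x y

theorem reduce_tensor (e : O ↪ Q) (f : O' ↪ Q') (M : Op Q) (N : Op Q') :
    reduce (e.sumMap f) (tensor M N) = tensor (reduce e M) (reduce f N) := by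
  obtain ⟨R, _, _, φ, rfl⟩ := exists_eq_leftPart e
  obtain ⟨R', _, _, ψ, rfl⟩ := exists_eq_leftPart f
  let χ : (O ⊕ O') ⊕ (R ⊕ R') ≃ Q ⊕ Q' :=
    (Equiv.sumSumSumComm O O' R R').trans (φ.sumCongr ψ)
  have hχ : (leftPart φ).sumMap (leftPart ψ) = leftPart χ := by
    ext z
    rcases z with z | z <;> simp [leftPart_apply, χ]
  ext x y
  rw [hχ]
  simp only [tensor, reduce_leftPart]
  have hs1 : ∀ (z : O ⊕ O' → Bool) (p : (R → Bool) × (R' → Bool)),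
      splitEquiv χ (z, splitEquiv (Equiv.refl _) p) ∘ Sum.inl
        = splitEquiv φ (z ∘ Sum.inl, p.1) := by
    rintro z ⟨r, r'⟩
    ext q
    obtain ⟨t, rfl⟩ := φ.surjective q
    rcases t with i | r <;> simp [splitEquiv_apply, χ]
  have hs2 : ∀ (z : O ⊕ O' → Bool) (p : (R → Bool) × (R' → Bool)),
      splitEquiv χ (z, splitEquiv (Equiv.refl _) p) ∘ Sum.inr
        = splitEquiv ψ (z ∘ Sum.inr, p.2) := by
    rintro z ⟨r, r'⟩
    ext q
    obtain ⟨t, rfl⟩ := ψ.surjective q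
    rcases t with i | r <;> simp [splitEquiv_apply, χ]
  rw [← Equiv.sum_comp (splitEquiv (Equiv.refl (R ⊕ R')))]
  simp only [hs1, hs2, Fintype.sum_prod_type, Finset.sum_mul_sum]

theorem reduce_inl_apply (M : Op (O ⊕ R)) (x y : O → Bool) :
    reduce Function.Embedding.inl M x y = ∑ r, M (Sum.elim x r) (Sum.elim y r) :=
  reduce_leftPart (Equiv.refl _) M x y

end Reduce

/-! ### Products of operators on disjoint registers. -/

section Tensor

variable {I J : Type} [Fintype I] [DecidableEq I] [Fintype J] [DecidableEq J]

theorem tensor_mul (A C : Op I) (B D : Op J) :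
    tensor A B * tensor C D = tensor (A * C) (B * D) := by
  ext x y
  rw [mul_splitEquiv (Equiv.refl _)]
  simp only [tensor, Matrix.mul_apply, Finset.sum_mul_sum]
  refine Finset.sum_congr rfl fun a _ => Finset.sum_congr rfl fun b _ => ?_
  exact mul_mul_mul_comm _ _ _ _

theorem conjTranspose_tensor (A : Op I) (B : Op J) : (tensor A B)ᴴ = tensor Aᴴ Bᴴ := by
  ext x y
  simp [tensor]

theorem liftOp_inl (K : Op I) :
    liftOp (Function.Embedding.inl : I ↪ I ⊕ J) K = tensor K (1 : Op J) := by
  ext x y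
  have h : (∀ q, q ∉ Set.range (Function.Embedding.inl : I ↪ I ⊕ J) → x q = y q)
      ↔ x ∘ Sum.inr = y ∘ Sum.inr := by
    simp [funext_iff]
  simp only [liftOp, tensor, h, Matrix.one_apply, mul_ite, mul_one, mul_zero]
  rfl

theorem liftOp_inr (K : Op J) :
    liftOp (Function.Embedding.inr : J ↪ I ⊕ J) K = tensor (1 : Op I) K := by
  ext x y
  have h : (∀ q, q ∉ Set.range (Function.Embedding.inr : J ↪ I ⊕ J) → x q = y q)
      ↔ x ∘ Sum.inl = y ∘ Sum.inl := by
    simp [funext_iff]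
  simp only [liftOp, tensor, h, Matrix.one_apply, ite_mul, one_mul, zero_mul]
  rfl

theorem tensor_basisState (a : I → Bool) (b : J → Bool) :
    tensor (basisState a) (basisState b) = basisState (Sum.elim a b) := by
  have h : ∀ z : I ⊕ J → Bool, z = Sum.elim a b ↔ z ∘ Sum.inl = a ∧ z ∘ Sum.inr = b := by
    intro z
    constructor
    · rintro rfl
      simp
    · rintro ⟨rfl, rfl⟩
      simp
  ext x y
  simp only [tensor, basisState, h]
  split_ifs <;> simp_all

end Tensor

/-! ### Lists of gates -/

section Gates

variable {O Q I J : Type} [Fintype O] [DecidableEq O] [Fintype Q] [DecidableEq Q]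
  [Fintype I] [DecidableEq I] [Fintype J] [DecidableEq J]

/-- The action of a list of gates on a state. -/
def applyGates (gs : List (QGate Q)) (M : Op Q) : Op Q :=
  gs.foldl (fun M g => g.op * M * (g.op)ᴴ) M

theorem applyGates_nil (M : Op Q) : applyGates [] M = M := rfl

theorem applyGates_cons (g : QGate Q) (gs : List (QGate Q)) (M : Op Q) :
    applyGates (g :: gs) M = applyGates gs (g.op * M * (g.op)ᴴ) := rfl

theorem applyGates_append (gs gs' : List (QGate Q)) (M : Op Q) :
    applyGates (gs ++ gs') M = applyGates gs' (applyGates gs M) :=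
  List.foldl_append

/-- The same gate on a larger register. -/
def QGate.map (e : O ↪ Q) (g : QGate O) : QGate Q where
  fst := e g.fst
  snd := e g.snd
  ne := fun h => g.ne (e.injective h)
  mat := g.mat

theorem QGate.op_map (e : O ↪ Q) (g : QGate O) : (g.map e).op = liftOp e g.op := by
  ext x y
  have h : (∀ q, q ≠ e g.fst → q ≠ e g.snd → x q = y q) ↔
      (∀ q, q ∉ Set.range e → x q = y q) ∧
        ∀ q, q ≠ g.fst → q ≠ g.snd → (x ∘ e) q = (y ∘ e) q := by
    constructor
    · intro h
      refine ⟨fun q hq => h q ?_ ?_, fun q h1 h2 => h _ ?_ ?_⟩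
      · rintro rfl; exact hq ⟨_, rfl⟩
      · rintro rfl; exact hq ⟨_, rfl⟩
      · simpa using h1
      · simpa using h2
    · rintro ⟨h1, h2⟩ q hq hq'
      by_cases hr : q ∈ Set.range e
      · obtain ⟨i, rfl⟩ := hr
        exact h2 i (by simpa using hq) (by simpa using hq')
      · exact h1 q hr
  simp only [QGate.op, QGate.map, liftOp, h, ite_and]
  congr!

/-- Discarding qubits that a circuit does not touch may be done before or after it. Composition of
circuits rests on this. -/
theorem reduce_applyGates_map (e : O ↪ Q) (gs : List (QGate O)) (M : Op Q) :
    reduce e (applyGates (gs.map (QGate.map e)) M) = applyGates gs (reduce e M) := by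
  induction gs generalizing M with
  | nil => rfl
  | cons g gs ih =>
    rw [List.map_cons, applyGates_cons, applyGates_cons, ih, QGate.op_map, reduce_liftOp]

theorem applyGates_map_inl (gs : List (QGate I)) (M : Op I) (N : Op J) :
    applyGates (gs.map (QGate.map Function.Embedding.inl)) (tensor M N)
      = tensor (applyGates gs M) N := by
  induction gs generalizing M with
  | nil => rfl
  | cons g gs ih =>
    rw [List.map_cons, applyGates_cons, applyGates_cons, QGate.op_map, liftOp_inl,
      conjTranspose_tensor, tensor_mul, tensor_mul, Matrix.conjTranspose_one, Matrix.mul_one,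
      Matrix.one_mul, ih]

theorem applyGates_map_inr (gs : List (QGate J)) (M : Op I) (N : Op J) :
    applyGates (gs.map (QGate.map Function.Embedding.inr)) (tensor M N)
      = tensor M (applyGates gs N) := by
  induction gs generalizing N with
  | nil => rfl
  | cons g gs ih =>
    rw [List.map_cons, applyGates_cons, applyGates_cons, QGate.op_map, liftOp_inr,
      conjTranspose_tensor, tensor_mul, tensor_mul, Matrix.conjTranspose_one, Matrix.mul_one,
      Matrix.one_mul, ih]

end Gates

/-! ### Composition of circuits -/

section Compose

variable {I O O' A B Q : Type} [Fintype I] [DecidableEq I] [Fintype O] [DecidableEq O]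
  [Fintype O'] [DecidableEq O'] [Fintype A] [DecidableEq A] [Fintype B] [DecidableEq B]
  [Fintype Q] [DecidableEq Q]

/-- The all-zero state. -/
def zeroState (Q : Type) : Op Q := basisState fun _ => false

theorem tensor_zeroState : tensor (zeroState A) (zeroState B) = zeroState (A ⊕ B) := by
  rw [zeroState, zeroState, tensor_basisState]
  congr
  ext z
  cases z <;> rfl

theorem reduce_equiv_zeroState (φ : A ≃ B) : reduce φ.toEmbedding (zeroState B) = zeroState A := by
  have h : ∀ x : A → Bool, (x ∘ φ.symm = fun _ => false) ↔ x = fun _ => false := by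
    intro x
    constructor
    · intro h
      ext i
      simpa using congrFun h (φ i)
    · rintro rfl
      rfl
  ext x y
  rw [reduce_equiv]
  simp only [zeroState, basisState, h]
  congr!

/-- The probability to measure `1` on the qubit `q`. -/
def acceptProb (q : Q) (M : Op Q) : ℝ := ∑ s : Q → Bool, if s q = true then (M s s).re else 0

theorem acceptProb_reduce (e : O ↪ Q) (q : O) (M : Op Q) :
    acceptProb q (reduce e M) = acceptProb (e q) M := by
  obtain ⟨R, _, _, φ, rfl⟩ := exists_eq_leftPart e
  have h : acceptProb (leftPart φ q) M = ∑ p : (O → Bool) × (R → Bool),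
      if p.1 q = true then (M (splitEquiv φ p) (splitEquiv φ p)).re else 0 := by
    unfold acceptProb
    refine (Fintype.sum_equiv (splitEquiv φ) _ _ fun p => ?_).symm
    rw [leftPart_apply, splitEquiv_inl]
  rw [h, Fintype.sum_prod_type, acceptProb]
  refine Finset.sum_congr rfl fun x _ => ?_
  rw [reduce_leftPart, Complex.re_sum]
  split_ifs <;> simp

theorem reduce_ancilla (φ : A ≃ B) (ρ : Op I) :
    reduce ((Equiv.refl I).sumCongr φ).toEmbedding (tensor ρ (zeroState B))
      = tensor ρ (zeroState A) := by
  have h : ((Equiv.refl I).sumCongr φ).toEmbedding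
      = (Function.Embedding.refl I).sumMap φ.toEmbedding := by
    ext z
    cases z <;> rfl
  rw [h, reduce_tensor, reduce_refl, reduce_equiv_zeroState]

/-- A preparation circuit on a register of any finite type. -/
theorem exists_qPrep (φ : Q ≃ I ⊕ A) (gs : List (QGate Q)) (out : O ↪ Q) :
    ∃ C : QPrep I O, C.size = Fintype.card A + gs.length ∧
      ∀ ρ, C.output ρ
        = reduce out (applyGates gs (reduce φ.toEmbedding (tensor ρ (zeroState A)))) := by
  -- Circuits number their ancillas by `Fin`; `ψ` only relabels.
  let ψ : Q ≃ I ⊕ Fin (Fintype.card A) :=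
    φ.trans ((Equiv.refl I).sumCongr (Fintype.equivFin A))
  refine ⟨⟨⟨Fintype.card A, gs.map (QGate.map ψ.toEmbedding)⟩, out.trans ψ.toEmbedding⟩, ?_, ?_⟩
  · simp [QCircuit.size]
  · intro ρ
    change reduce (out.trans ψ.toEmbedding)
      (applyGates (gs.map (QGate.map ψ.toEmbedding)) (tensor ρ (zeroState _))) = _
    rw [reduce_trans, reduce_applyGates_map]
    have h : ψ.toEmbedding = φ.toEmbedding.trans
      ((Equiv.refl I).sumCongr (Fintype.equivFin A)).toEmbedding := rfl
    rw [h, reduce_trans, reduce_ancilla]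

/-- A test circuit on a register of any finite type. -/
theorem exists_qTest (φ : Q ≃ I ⊕ A) (gs : List (QGate Q)) (acc : Q) :
    ∃ C : QTest I, C.size = Fintype.card A + gs.length ∧
      ∀ ρ, C.prob ρ
        = acceptProb acc (applyGates gs (reduce φ.toEmbedding (tensor ρ (zeroState A)))) := by
  let ψ : Q ≃ I ⊕ Fin (Fintype.card A) :=
    φ.trans ((Equiv.refl I).sumCongr (Fintype.equivFin A))
  refine ⟨⟨⟨Fintype.card A, gs.map (QGate.map ψ.toEmbedding)⟩, ψ acc⟩, ?_, ?_⟩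
  · simp [QCircuit.size]
  · intro ρ
    change acceptProb (ψ.toEmbedding acc)
      (applyGates (gs.map (QGate.map ψ.toEmbedding)) (tensor ρ (zeroState _))) = _
    rw [← acceptProb_reduce, reduce_applyGates_map]
    have h : ψ.toEmbedding = φ.toEmbedding.trans
      ((Equiv.refl I).sumCongr (Fintype.equivFin A)).toEmbedding := rfl
    rw [h, reduce_trans, reduce_ancilla]

/-- Running a second circuit on the output of a preparation circuit. -/
theorem reduce_applyGates_compose (C : QPrep I O) (gs : List (QGate (O ⊕ B))) (ρ : Op I) :
    reduce (C.out.sumMap (Function.Embedding.refl B))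
      (applyGates (C.gates.map (QGate.map Function.Embedding.inl)
          ++ gs.map (QGate.map (C.out.sumMap (Function.Embedding.refl B))))
        (reduce (Equiv.sumAssoc I (Fin C.anc) B).toEmbedding
          (tensor ρ (zeroState (Fin C.anc ⊕ B)))))
      = applyGates gs (tensor (C.output ρ) (zeroState B)) := by
  have h : reduce (Equiv.sumAssoc I (Fin C.anc) B).toEmbedding
      (tensor ρ (zeroState (Fin C.anc ⊕ B)))
        = tensor (tensor ρ (zeroState (Fin C.anc))) (zeroState B) := by
    rw [← tensor_zeroState]
    ext x y
    rw [reduce_equiv]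
    exact (mul_assoc _ _ _).symm
  rw [h, applyGates_append, reduce_applyGates_map, applyGates_map_inl, reduce_tensor, reduce_refl]
  rfl

/-- The qubits that `C` discards stay in the register and are traced out at the end, so no extra
gates are needed and the sizes add. -/
theorem exists_comp_qPrep (C : QPrep I O) (C' : QPrep O O') :
    ∃ D : QPrep I O', D.size = C.size + C'.size ∧ ∀ ρ, D.output ρ = C'.output (C.output ρ) := by
  obtain ⟨D, hs, hD⟩ := exists_qPrep (Equiv.sumAssoc I (Fin C.anc) (Fin C'.anc))
    (C.gates.map (QGate.map Function.Embedding.inl)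
      ++ C'.gates.map (QGate.map (C.out.sumMap (Function.Embedding.refl _))))
    (C'.out.trans (C.out.sumMap (Function.Embedding.refl _)))
  refine ⟨D, ?_, fun ρ => ?_⟩
  · rw [hs]
    simp only [QCircuit.size, Fintype.card_sum, Fintype.card_fin, List.length_append,
      List.length_map]
    ring
  · rw [hD, reduce_trans, reduce_applyGates_compose]
    rfl

theorem exists_comp_qTest (C : QPrep I O) (T : QTest O) :
    ∃ D : QTest I, D.size = C.size + T.size ∧ ∀ ρ, D.prob ρ = T.prob (C.output ρ) := by
  obtain ⟨D, hs, hD⟩ := exists_qTest (Equiv.sumAssoc I (Fin C.anc) (Fin T.anc))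
    (C.gates.map (QGate.map Function.Embedding.inl)
      ++ T.gates.map (QGate.map (C.out.sumMap (Function.Embedding.refl _))))
    (C.out.sumMap (Function.Embedding.refl _) T.acc)
  refine ⟨D, ?_, fun ρ => ?_⟩
  · rw [hs]
    simp only [QCircuit.size, Fintype.card_sum, Fintype.card_fin, List.length_append,
      List.length_map]
    ring
  · rw [hD, ← acceptProb_reduce, reduce_applyGates_compose]
    rfl

end Compose

/-! ### Linearity -/

section Linear

variable {I O Q : Type} [Fintype I] [DecidableEq I] [Fintype O] [DecidableEq O]
  [Fintype Q] [DecidableEq Q]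

theorem isLinearMap_reduce (e : O ↪ Q) : IsLinearMap ℂ (reduce e) := by
  obtain ⟨R, _, _, φ, rfl⟩ := exists_eq_leftPart e
  constructor
  · intro M N
    ext x y
    simp [reduce_leftPart, Finset.sum_add_distrib]
  · intro c M
    ext x y
    simp [reduce_leftPart, Finset.mul_sum]

theorem isLinearMap_applyGates (gs : List (QGate Q)) : IsLinearMap ℂ (applyGates gs) := by
  induction gs with
  | nil => exact ⟨fun _ _ => rfl, fun _ _ => rfl⟩
  | cons g gs ih =>
    constructor
    · intro M N
      simp only [applyGates_cons, Matrix.mul_add, Matrix.add_mul, ih.map_add]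
    · intro c M
      simp only [applyGates_cons, Matrix.mul_smul, Matrix.smul_mul, ih.map_smul]

theorem isLinearMap_run (C : QCircuit I) : IsLinearMap ℂ C.run := by
  have h := isLinearMap_applyGates C.gates
  constructor
  · intro M N
    change applyGates _ _ = applyGates _ _ + applyGates _ _
    rw [← h.map_add]
    congr 1
    ext x y
    simp [tensor, add_mul]
  · intro c M
    change applyGates _ _ = c • applyGates _ _
    rw [← h.map_smul]
    congr 1
    ext x y
    simp [tensor, mul_assoc]

theorem isLinearMap_output (C : QPrep I O) : IsLinearMap ℂ C.output :=
  ((isLinearMap_reduce C.out).mk'.comp (isLinearMap_run C.toQCircuit).mk').isLinear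

/-- The probability to measure `1`, as a linear functional. -/
theorem exists_linearMap_prob (T : QTest I) :
    ∃ L : Op I →ₗ[ℂ] ℂ, ∀ ρ, T.prob ρ = (L ρ).re := by
  have h := isLinearMap_run T.toQCircuit
  refine ⟨IsLinearMap.mk' (fun ρ => ∑ s : I ⊕ Fin T.anc → Bool,
    if s T.acc = true then T.run ρ s s else 0) ⟨?_, ?_⟩, ?_⟩
  · intro M N
    rw [← Finset.sum_add_distrib]
    refine Finset.sum_congr rfl fun s _ => ?_
    rw [h.map_add]
    split_ifs <;> simp
  · intro c M
    rw [Finset.smul_sum]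
    refine Finset.sum_congr rfl fun s _ => ?_
    rw [h.map_smul]
    split_ifs <;> simp
  · intro ρ
    simp only [IsLinearMap.mk'_apply, QTest.prob, Complex.re_sum]
    refine Finset.sum_congr rfl fun s _ => ?_
    split_ifs <;> simp

theorem map_keyAvg {E F : Type} [AddCommGroup E] [Module ℂ E] [Module ℝ E] [IsScalarTower ℝ ℂ E]
    [AddCommGroup F] [Module ℂ F] [Module ℝ F] [IsScalarTower ℝ ℂ F]
    (L : E →ₗ[ℂ] F) {l : ℕ} (f : (Fin l → Bool) → E) :
    L (keyAvg f) = keyAvg fun k => L (f k) := by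
  simp only [keyAvg]
  rw [LinearMap.map_smul_of_tower, map_sum]

theorem output_keyAvg (C : QPrep I O) {l : ℕ} (f : (Fin l → Bool) → Op I) :
    C.output (keyAvg f) = keyAvg fun k => C.output (f k) :=
  map_keyAvg (isLinearMap_output C).mk' f

theorem prob_keyAvg (T : QTest I) {l : ℕ} (f : (Fin l → Bool) → Op I) :
    T.prob (keyAvg f) = keyAvg fun k => T.prob (f k) := by
  obtain ⟨L, hL⟩ := exists_linearMap_prob T
  simp only [hL, map_keyAvg]
  simp only [keyAvg, Complex.smul_re, Complex.re_sum]

end Linear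

/-! ### Preparation of product states of pairs of qubits -/

section Pairs

/-- A unit vector is a column of a unitary matrix. -/
theorem exists_unitary_column {ι : Type} [Fintype ι] [DecidableEq ι] (u : ι → ℂ)
    (hu : ∑ i, Complex.normSq (u i) = 1) (i₀ : ι) :
    ∃ W : Matrix.unitaryGroup ι ℂ, ∀ i, (W : Matrix ι ι ℂ) i i₀ = u i := by
  have hn : ‖(WithLp.toLp 2 u : EuclideanSpace ℂ ι)‖ = 1 := by
    rw [EuclideanSpace.norm_eq, Real.sqrt_eq_one, ← hu]
    simp [Complex.normSq_eq_norm_sq]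
  -- Extend the single vector `u`, placed at index `i₀`, to an orthonormal basis.
  obtain ⟨b, hb⟩ := Orthonormal.exists_orthonormalBasis_extension_of_card_eq
    (𝕜 := ℂ) (E := EuclideanSpace ℂ ι) (ι := ι) (by simp)
    (v := fun _ => WithLp.toLp 2 u) (s := {i₀}) (by
      constructor
      · intro i
        simpa using hn
      · intro i j hij
        exact absurd (Subsingleton.elim i j) hij)
  refine ⟨⟨(EuclideanSpace.basisFun ι ℂ).toBasis.toMatrix b,
    OrthonormalBasis.toMatrix_orthonormalBasis_mem_unitary _ _⟩, fun i => ?_⟩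
  simp [Module.Basis.toMatrix_apply, hb i₀ rfl]

variable {J : Type} [Fintype J] [DecidableEq J]

/-- A gate on the two qubits of the pair `j`. -/
def pairGate (W : J → Matrix.unitaryGroup (Bool × Bool) ℂ) (j : J) : QGate (J × Bool) :=
  ⟨(j, false), (j, true), by simp, W j⟩

/-- The product vector with factors `u j` on the pairs in `S` and `|00⟩` on the others. -/
def pairVec (u : J → Bool × Bool → ℂ) (S : Finset J) (x : J × Bool → Bool) : ℂ :=
  ∏ j, if j ∈ S then u j (x (j, false), x (j, true)) else
    if x (j, false) = false ∧ x (j, true) = false then 1 else 0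

theorem pairGate_mulVec (W : J → Matrix.unitaryGroup (Bool × Bool) ℂ) (u : J → Bool × Bool → ℂ)
    (hW : ∀ j i, (W j : Matrix (Bool × Bool) (Bool × Bool) ℂ) i (false, false) = u j i)
    {j : J} {S : Finset J} (hj : j ∉ S) :
    (pairGate W j).op *ᵥ pairVec u S = pairVec u (insert j S) := by
  ext x
  -- The only string contributing to the sum: the pair `j` is still in `|00⟩`, and the gate changes
  -- no other qubit. Hence only the column `(false, false)` of `W j` matters.
  let y₀ : J × Bool → Bool := fun q => if q.1 = j then false else x q
  have hop : ∀ y, (pairGate W j).op x y = if ∀ q : J × Bool, q.1 ≠ j → x q = y q then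
      (W j : Matrix (Bool × Bool) (Bool × Bool) ℂ) (x (j, false), x (j, true))
        (y (j, false), y (j, true)) else 0 := by
    intro y
    have h : (∀ q, q ≠ (j, false) → q ≠ (j, true) → x q = y q) ↔
        ∀ q : J × Bool, q.1 ≠ j → x q = y q := by
      constructor
      · intro h q hq
        exact h q (by rintro rfl; exact hq rfl) (by rintro rfl; exact hq rfl)
      · rintro h ⟨i, b⟩ h1 h2
        refine h _ ?_
        rintro rfl
        cases b <;> simp_all
    simp only [QGate.op, pairGate, h]
  rw [Matrix.mulVec, dotProduct, Finset.sum_eq_single y₀]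
  · rw [hop, if_pos (by intro q hq; simp [y₀, hq])]
    simp only [pairVec]
    rw [Fintype.prod_eq_mul_prod_compl j, Fintype.prod_eq_mul_prod_compl j]
    simp only [y₀, if_true, hW, hj, if_false, and_self, one_mul, Finset.mem_insert_self]
    congr 1
    refine Finset.prod_congr rfl fun i hi => ?_
    have hij : i ≠ j := by simpa using hi
    simp [hij]
  · intro y _ hy
    rw [hop]
    split_ifs with h
    · have hz : pairVec u S y = 0 := by
        refine Finset.prod_eq_zero (Finset.mem_univ j) ?_
        rw [if_neg hj, if_neg]
        rintro ⟨h1, h2⟩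
        apply hy
        ext ⟨i, b⟩
        simp only [y₀]
        split_ifs with hi
        · subst hi
          cases b <;> assumption
        · exact (h _ hi).symm
      rw [hz, mul_zero]
    · rw [zero_mul]
  · simp

theorem conj_vecMulVec {ι : Type} [Fintype ι] (U : Matrix ι ι ℂ) (v : ι → ℂ) :
    U * Matrix.vecMulVec v (star v) * Uᴴ = Matrix.vecMulVec (U *ᵥ v) (star (U *ᵥ v)) := by
  rw [Matrix.mul_vecMulVec, Matrix.vecMulVec_mul, Matrix.star_mulVec]

/-- `S` records the pairs already prepared; it is general so that the induction can move each
treated pair into it. -/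
theorem applyGates_pairGate (W : J → Matrix.unitaryGroup (Bool × Bool) ℂ)
    (u : J → Bool × Bool → ℂ)
    (hW : ∀ j i, (W j : Matrix (Bool × Bool) (Bool × Bool) ℂ) i (false, false) = u j i)
    (l : List J) (hl : l.Nodup) (S : Finset J) (hS : ∀ j ∈ l, j ∉ S) :
    applyGates (l.map (pairGate W)) (Matrix.vecMulVec (pairVec u S) (star (pairVec u S)))
      = Matrix.vecMulVec (pairVec u (S ∪ l.toFinset)) (star (pairVec u (S ∪ l.toFinset))) := by
  induction l generalizing S with
  | nil => simp [applyGates_nil]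
  | cons j l ih =>
    rw [List.nodup_cons] at hl
    rw [List.map_cons, applyGates_cons, conj_vecMulVec, pairGate_mulVec W u hW (hS j (by simp)),
      ih hl.2]
    · simp
    · intro i hi
      rw [Finset.mem_insert, not_or]
      exact ⟨fun h => hl.1 (h ▸ hi), hS i (by simp [hi])⟩

theorem vecMulVec_pairVec_empty (u : J → Bool × Bool → ℂ) :
    Matrix.vecMulVec (pairVec u ∅) (star (pairVec u ∅)) = zeroState (J × Bool) := by
  have h : ∀ x, pairVec u ∅ x = if x = fun _ => false then 1 else 0 := by
    intro x
    simp only [pairVec, Finset.notMem_empty, if_false]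
    rw [Finset.prod_ite_zero]
    simp [funext_iff]
  ext x y
  simp only [Matrix.vecMulVec_apply, Pi.star_apply, h, zeroState, basisState]
  split_ifs <;> simp_all

/-- Product states of pairs of qubits are prepared by one gate for each pair. -/
theorem exists_gates_pairVec (u : J → Bool × Bool → ℂ)
    (hu : ∀ j, ∑ i, Complex.normSq (u j i) = 1) :
    ∃ gs : List (QGate (J × Bool)), gs.length = Fintype.card J ∧
      applyGates gs (zeroState (J × Bool)) = Matrix.vecMulVec
        (fun x => ∏ j, u j (x (j, false), x (j, true)))
        (star fun x => ∏ j, u j (x (j, false), x (j, true))) := by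
  choose W hW using fun j => exists_unitary_column (u j) (hu j) (false, false)
  refine ⟨Finset.univ.toList.map (pairGate W), by simp, ?_⟩
  rw [← vecMulVec_pairVec_empty u, applyGates_pairGate W u hW _ (Finset.nodup_toList _) _ (by simp)]
  have h : pairVec u (∅ ∪ (Finset.univ : Finset J).toList.toFinset)
      = fun x => ∏ j, u j (x (j, false), x (j, true)) := by
    ext x
    simp [pairVec]
  rw [h]

end Pairs

/-! ### Uniformly random keys -/

theorem basisState_apply {Q : Type} [Fintype Q] [DecidableEq Q] (k x y : Q → Bool) :
    basisState k x y = if x = k ∧ y = k then 1 else 0 := by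
  simp only [basisState]
  congr!

/-- Half of a Bell pair is a uniformly random bit. Each key bit costs two ancillas and one gate. -/
theorem exists_qPrep_randomKey (l : ℕ) :
    ∃ C : QPrep Empty (Fin l), C.size = 3 * l ∧
      C.output (basisState Empty.elim) = keyAvg fun k => basisState k := by
  obtain ⟨gs, hgs, hgs'⟩ := exists_gates_pairVec (J := Fin l)
    (fun _ p => if p.1 = p.2 then ((√2)⁻¹ : ℝ) else 0) (by
      intro _
      simp [Fintype.sum_prod_type, Complex.normSq_ofReal]
      norm_num)
  let ψ : Fin l ⊕ Fin l ≃ Fin l × Bool :=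
    ((Equiv.boolProdEquivSum (Fin l)).symm).trans (Equiv.prodComm _ _)
  obtain ⟨C, hs, hC⟩ := exists_qPrep (Equiv.emptySum Empty (Fin l × Bool)).symm gs (leftPart ψ)
  refine ⟨C, by simp [hs, hgs]; ring, ?_⟩
  have h0 : reduce (Equiv.emptySum Empty (Fin l × Bool)).symm.toEmbedding
      (tensor (basisState Empty.elim) (zeroState (Fin l × Bool))) = zeroState _ := by
    ext x y
    rw [reduce_equiv]
    simp only [tensor, basisState_apply]
    rw [if_pos (by constructor <;> exact Subsingleton.elim _ _), one_mul]
    rfl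
  rw [hC, h0, hgs']
  ext x y
  rw [reduce_leftPart]
  have h1 : ∀ (z r : Fin l → Bool) i, splitEquiv ψ (z, r) (i, false) = z i := by
    intro z r i
    exact splitEquiv_inl ψ (z, r) i
  have h2 : ∀ (z r : Fin l → Bool) i, splitEquiv ψ (z, r) (i, true) = r i := by
    intro z r i
    exact splitEquiv_inr ψ (z, r) i
  have h3 : ∀ (z r : Fin l → Bool) (c : ℂ),
      (∏ j, if z j = r j then c else 0) = if z = r then c ^ l else 0 := by
    intro z r c
    rw [Finset.prod_ite_zero]
    simp [funext_iff]
  simp only [Matrix.vecMulVec_apply, Pi.star_apply, h1, h2, h3, keyAvg, Matrix.smul_apply,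
    Matrix.sum_apply, basisState_apply, apply_ite star, star_zero, ite_mul, zero_mul,
    mul_ite, mul_zero, ite_and, Finset.sum_ite_eq, Finset.mem_univ, if_true]
  change (if x = y then _ else _) = _
  rcases eq_or_ne x y with rfl | hxy
  · rw [if_pos rfl, if_pos rfl, ← Complex.ofReal_pow, Complex.star_def, Complex.conj_ofReal,
      ← Complex.ofReal_mul, ← mul_pow, ← mul_inv, Real.mul_self_sqrt (by norm_num), inv_pow]
    simp
  · rw [if_neg hxy, if_neg hxy.symm, smul_zero]

/-! ### Controlled operators -/

section Controlled

variable {I J : Type} [Fintype I] [DecidableEq I] [Fintype J] [DecidableEq J]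

/-- The operator that applies `W a` to the register `I` if the register `J` is in the basis
state `a`. -/
def ctrl (W : (J → Bool) → Op I) : Op (I ⊕ J) := fun x y =>
  if x ∘ Sum.inr = y ∘ Sum.inr then W (x ∘ Sum.inr) (x ∘ Sum.inl) (y ∘ Sum.inl) else 0

theorem ctrl_elim (W : (J → Bool) → Op I) (x y : I → Bool) (a b : J → Bool) :
    ctrl W (Sum.elim x a) (Sum.elim y b) = if a = b then W a x y else 0 := by
  simp only [ctrl, Sum.elim_comp_inl, Sum.elim_comp_inr]
  congr!

theorem mul_elim_apply (A B : Op (I ⊕ J)) (s s' : I ⊕ J → Bool) :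
    (A * B) s s' = ∑ x, ∑ a, A s (Sum.elim x a) * B (Sum.elim x a) s' :=
  mul_splitEquiv (Equiv.refl (I ⊕ J)) A B s s'

theorem ctrl_mul (W W' : (J → Bool) → Op I) : ctrl W * ctrl W' = ctrl fun a => W a * W' a := by
  ext s t
  obtain ⟨⟨x, a⟩, rfl⟩ := (splitEquiv (Equiv.refl (I ⊕ J))).surjective s
  obtain ⟨⟨y, b⟩, rfl⟩ := (splitEquiv (Equiv.refl (I ⊕ J))).surjective t
  change (ctrl W * ctrl W') (Sum.elim x a) (Sum.elim y b)
    = ctrl (fun a => W a * W' a) (Sum.elim x a) (Sum.elim y b)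
  simp only [mul_elim_apply, ctrl_elim, ite_mul, zero_mul, Finset.sum_ite_eq, Finset.mem_univ,
    if_true]
  split_ifs <;> simp [Matrix.mul_apply]

/-- Once the control register is discarded, its coherences are invisible: its diagonal entries act
as weights for the choice of `W a`. -/
theorem reduce_ctrl (W : (J → Bool) → Op I) (ρ : Op I) (N : Op J) :
    reduce Function.Embedding.inl (ctrl W * tensor ρ N * (ctrl W)ᴴ)
      = ∑ a, N a a • (W a * ρ * (W a)ᴴ) := by
  ext x y
  simp only [reduce_inl_apply, mul_elim_apply, ctrl_elim, Matrix.conjTranspose_apply, ite_mul,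
    zero_mul, Finset.sum_ite_eq, Finset.mem_univ, if_true, apply_ite star, star_zero, mul_ite,
    mul_zero, tensor, Sum.elim_comp_inl, Sum.elim_comp_inr]
  simp only [Matrix.sum_apply, Matrix.smul_apply, Matrix.mul_apply, Matrix.conjTranspose_apply,
    smul_eq_mul, Finset.mul_sum, Finset.sum_mul]
  refine Finset.sum_congr rfl fun a _ => Finset.sum_congr rfl fun z _ =>
    Finset.sum_congr rfl fun w _ => ?_
  ring

/-- The tensor product of operators on single qubits. -/
def siteOp (V : I → Matrix Bool Bool ℂ) : Op I := fun x y => ∏ i, V i (x i) (y i)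

theorem siteOp_mul (V V' : I → Matrix Bool Bool ℂ) :
    siteOp V * siteOp V' = siteOp fun i => V i * V' i := by
  ext x y
  simp only [siteOp, Matrix.mul_apply, ← Finset.prod_mul_distrib, Finset.prod_univ_sum,
    Fintype.piFinset_univ]

theorem siteOp_one : siteOp (fun _ : I => (1 : Matrix Bool Bool ℂ)) = 1 := by
  ext x y
  simp only [siteOp, Matrix.one_apply]
  rw [Finset.prod_ite_zero]
  simp [funext_iff]

theorem siteOp_smul (c : I → ℂ) (V : I → Matrix Bool Bool ℂ) :
    siteOp (fun i => c i • V i) = (∏ i, c i) • siteOp V := by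
  ext x y
  simp [siteOp, Finset.prod_mul_distrib]

theorem conjTranspose_siteOp (V : I → Matrix Bool Bool ℂ) :
    (siteOp V)ᴴ = siteOp fun i => (V i)ᴴ := by
  ext x y
  simp [siteOp]

/-- The two-qubit gate that applies `V b` to the target `i` if the control `q` is `b`. -/
def ctrlGate (V : Bool → Matrix.unitaryGroup Bool ℂ) (i : I) (q : J) : QGate (I ⊕ J) where
  fst := Sum.inl i
  snd := Sum.inr q
  ne := by simp
  mat := ⟨Matrix.blockDiagonal fun b => (V b : Matrix Bool Bool ℂ), by
    rw [Matrix.mem_unitaryGroup_iff, Matrix.star_eq_conjTranspose,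
      Matrix.blockDiagonal_conjTranspose, ← Matrix.blockDiagonal_mul, ← Matrix.blockDiagonal_one]
    congr 1
    ext b : 1
    exact Matrix.mem_unitaryGroup_iff.mp (V b).2⟩

theorem ctrlGate_op (V : Bool → Matrix.unitaryGroup Bool ℂ) (i : I) (q : J) :
    (ctrlGate V i q).op
      = ctrl fun a => siteOp fun j => if j = i then (V (a q) : Matrix Bool Bool ℂ) else 1 := by
  ext s t
  obtain ⟨⟨x, a⟩, rfl⟩ := (splitEquiv (Equiv.refl (I ⊕ J))).surjective s
  obtain ⟨⟨y, b⟩, rfl⟩ := (splitEquiv (Equiv.refl (I ⊕ J))).surjective t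
  change (ctrlGate V i q).op (Sum.elim x a) (Sum.elim y b)
    = ctrl _ (Sum.elim x a) (Sum.elim y b)
  rw [ctrl_elim]
  have h1 : (siteOp fun j => if j = i then (V (a q) : Matrix Bool Bool ℂ) else 1) x y
      = if ∀ j, j ≠ i → x j = y j then (V (a q) : Matrix Bool Bool ℂ) (x i) (y i) else 0 := by
    rw [siteOp, Fintype.prod_eq_mul_prod_compl i, if_pos rfl]
    have : ∀ j ∈ ({i} : Finset I)ᶜ, (if j = i then (V (a q) : Matrix Bool Bool ℂ) else 1) (x j) (y j)
        = if x j = y j then 1 else 0 := by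
      intro j hj
      rw [if_neg (by simpa using hj), Matrix.one_apply]
    rw [Finset.prod_congr rfl this, Finset.prod_ite_zero]
    simp
  rw [h1]
  have h2 : (∀ z : I ⊕ J, z ≠ Sum.inl i → z ≠ Sum.inr q →
      (Sum.elim x a : I ⊕ J → Bool) z = (Sum.elim y b : I ⊕ J → Bool) z) ↔
      (∀ j, j ≠ i → x j = y j) ∧ ∀ r, r ≠ q → a r = b r := by
    constructor
    · intro h
      exact ⟨fun j hj => h (Sum.inl j) (by simpa using hj) (by simp),
        fun r hr => h (Sum.inr r) (by simp) (by simpa using hr)⟩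
    · rintro ⟨h, h'⟩ (j | r) hz hz'
      · exact h j (by simpa using hz)
      · exact h' r (by simpa using hz')
  have h3 : a = b ↔ (∀ r, r ≠ q → a r = b r) ∧ a q = b q := by
    constructor
    · rintro rfl
      simp
    · rintro ⟨h, h'⟩
      ext r
      by_cases hr : r = q
      · rw [hr, h']
      · rw [h r hr]
  simp only [QGate.op, ctrlGate, h2, h3, Matrix.blockDiagonal_apply, Sum.elim_inl, Sum.elim_inr]
  split_ifs <;> simp_all

/-- The targets are distinct, so each site receives its factor once and the gates multiply to one
controlled product operator. -/
theorem applyGates_ctrlGate (V : Bool → Matrix.unitaryGroup Bool ℂ) (q : I → J)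
    (l : List I) (hl : l.Nodup) (M : Op (I ⊕ J)) :
    applyGates (l.map fun i => ctrlGate V i (q i)) M =
      (ctrl fun a => siteOp fun j => if j ∈ l then (V (a (q j)) : Matrix Bool Bool ℂ) else 1) * M *
      (ctrl fun a => siteOp fun j => if j ∈ l then (V (a (q j)) : Matrix Bool Bool ℂ) else 1)ᴴ := by
  induction l generalizing M with
  | nil =>
    have h : (ctrl fun _ => 1 : Op (I ⊕ J)) = 1 := by
      ext s t
      simp only [ctrl, Matrix.one_apply, ← ite_and]
      congr 1
      rw [eq_iff_iff]
      constructor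
      · rintro ⟨h1, h2⟩
        ext (z | z)
        · exact congrFun h2 z
        · exact congrFun h1 z
      · rintro rfl
        exact ⟨rfl, rfl⟩
    simp [applyGates_nil, siteOp_one, h]
  | cons i l ih =>
    rw [List.nodup_cons] at hl
    have h : (ctrl fun a => siteOp fun j => if j ∈ i :: l then (V (a (q j)) : Matrix Bool Bool ℂ)
          else 1)
        = (ctrl fun a => siteOp fun j => if j ∈ l then (V (a (q j)) : Matrix Bool Bool ℂ) else 1)
          * (ctrlGate V i (q i)).op := by
      rw [ctrlGate_op, ctrl_mul]
      congr 1
      ext a : 1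
      rw [siteOp_mul]
      congr 1
      ext j : 1
      by_cases hj : j = i
      · subst hj
        simp [hl.1]
      · simp [hj]
    rw [List.map_cons, applyGates_cons, ih hl.2, h, Matrix.conjTranspose_mul]
    simp only [Matrix.mul_assoc]

end Controlled

/-! ### The depolarizing channel as a circuit -/

section Noise

theorem Pauli.mat_mul_conjTranspose (P : Pauli) : P.mat * (P.mat)ᴴ = 1 := by
  ext a b
  rw [Matrix.mul_apply, Fintype.sum_bool]
  simp only [Matrix.conjTranspose_apply]
  cases P <;> cases a <;> cases b <;> simp [Pauli.mat]

/-- The Pauli operator, as a unitary matrix, if the control is set. -/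
def Pauli.ctrl (P : Pauli) (b : Bool) : Matrix.unitaryGroup Bool ℂ :=
  if b then ⟨P.mat, Matrix.mem_unitaryGroup_iff.mpr P.mat_mul_conjTranspose⟩ else 1

/-- The Pauli operator `Z^b X^a`, up to a phase. -/
def pauliOf : Bool → Bool → Pauli
  | false, false => .I
  | true, false => .X
  | true, true => .Y
  | false, true => .Z

/-- The phase of `Z^b X^a`. -/
def pauliPhase (a b : Bool) : ℂ := if a && b then Complex.I else 1

theorem pauliPhase_mul_star (a b : Bool) : pauliPhase a b * star (pauliPhase a b) = 1 := by
  cases a <;> cases b <;> simp [pauliPhase]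

theorem ctrl_Z_mul_ctrl_X (a b : Bool) :
    (Pauli.Z.ctrl b : Matrix Bool Bool ℂ) * (Pauli.X.ctrl a : Matrix Bool Bool ℂ)
      = pauliPhase a b • (pauliOf a b).mat := by
  ext i j
  rw [Matrix.mul_apply, Fintype.sum_bool, Matrix.smul_apply]
  cases a <;> cases b <;> simp only [Pauli.ctrl, pauliPhase, pauliOf] <;>
    cases i <;> cases j <;> simp <;> simp [Pauli.mat]

/-- Pauli operators are labelled by two bits. -/
def pauliEquiv : (Bool → Bool) ≃ Pauli where
  toFun f := pauliOf (f false) (f true)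
  invFun
    | .I => fun _ => false
    | .X => fun b => !b
    | .Y => fun _ => true
    | .Z => fun b => b
  left_inv f := by
    ext b
    rcases h : f false <;> rcases h' : f true <;> cases b <;> simp [pauliOf, h, h']
  right_inv P := by cases P <;> rfl

/-- Pauli strings are labelled by two bits for each qubit. -/
def pauliStringEquiv (n : ℕ) : (Fin n × Bool → Bool) ≃ (Fin n → Pauli) :=
  (Equiv.curry (Fin n) Bool Bool).trans (Equiv.piCongrRight fun _ => pauliEquiv)

theorem depolWeight_nonneg {p : ℝ} (hp : 0 ≤ p ∧ p ≤ 1) (s : Pauli) : 0 ≤ depolWeight p s := by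
  cases s <;> simp only [depolWeight] <;> linarith

theorem sum_pauli {M : Type} [AddCommMonoid M] (f : Pauli → M) :
    ∑ s, f s = f .I + (f .X + (f .Y + f .Z)) := by
  change ∑ s ∈ ({.I, .X, .Y, .Z} : Finset Pauli), f s = _
  rw [Finset.sum_insert (by simp), Finset.sum_insert (by simp), Finset.sum_insert (by simp),
    Finset.sum_singleton]

theorem sum_depolWeight (p : ℝ) : ∑ s, depolWeight p s = 1 := by
  rw [sum_pauli]
  simp only [depolWeight]
  ring

/-- The depolarizing channel is implemented by a circuit of linear size. -/
theorem exists_qPrep_depolarize (n : ℕ) {p : ℝ} (hp : 0 ≤ p ∧ p ≤ 1) :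
    ∃ C : QPrep (Fin n) (Fin n), C.size = 5 * n ∧ ∀ ρ, C.output ρ = depolarize p ρ := by
  -- Each qubit gets two ancillas whose amplitudes are square roots of the Pauli probabilities; they
  -- control `X` and then `Z`, and are discarded. Ancillas, pair gates and controlled gates number
  -- `2n + n + 2n`.
  obtain ⟨gs, hgs, hgs'⟩ := exists_gates_pairVec (J := Fin n)
    (fun _ ab => ((√(depolWeight p (pauliOf ab.1 ab.2)) : ℝ) : ℂ)) (by
      intro _
      simp only [Complex.normSq_ofReal, Real.mul_self_sqrt (depolWeight_nonneg hp _)]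
      rw [Fintype.sum_prod_type, ← sum_depolWeight p, sum_pauli]
      simp only [Fintype.sum_bool, pauliOf]
      ring)
  set v : (Fin n × Bool → Bool) → ℂ := fun x =>
    ∏ j, ((√(depolWeight p (pauliOf (x (j, false)) (x (j, true)))) : ℝ) : ℂ) with hv
  change applyGates gs (zeroState _) = Matrix.vecMulVec v (star v) at hgs'
  obtain ⟨C, hs, hC⟩ := exists_qPrep (Equiv.refl (Fin n ⊕ (Fin n × Bool)))
    (gs.map (QGate.map Function.Embedding.inr)
      ++ ((List.finRange n).map fun i => ctrlGate Pauli.X.ctrl i (i, false))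
      ++ ((List.finRange n).map fun i => ctrlGate Pauli.Z.ctrl i (i, true)))
    Function.Embedding.inl
  refine ⟨C, by simp [hs, hgs]; ring, fun ρ => ?_⟩
  have h0 : reduce (Equiv.refl (Fin n ⊕ (Fin n × Bool))).toEmbedding
      (tensor ρ (zeroState (Fin n × Bool))) = tensor ρ (zeroState _) := reduce_refl _
  rw [hC, h0, applyGates_append, applyGates_append, applyGates_map_inr, hgs',
    applyGates_ctrlGate _ (fun i => (i, false)) _ (List.nodup_finRange n),
    applyGates_ctrlGate _ (fun i => (i, true)) _ (List.nodup_finRange n)]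
  simp only [List.mem_finRange, if_true]
  have hW : ∀ A B X : Op (Fin n ⊕ (Fin n × Bool)), A * (B * X * Bᴴ) * Aᴴ
      = (A * B) * X * (A * B)ᴴ := by
    intro A B X
    rw [Matrix.conjTranspose_mul]
    simp only [Matrix.mul_assoc]
  rw [hW, ctrl_mul, reduce_ctrl, depolarize]
  refine Fintype.sum_equiv (pauliStringEquiv n) _ _ fun a => ?_
  have h1 : Matrix.vecMulVec v (star v) a a = ((∏ i, depolWeight p (pauliStringEquiv n a i) : ℝ) : ℂ) := by
    have hva : v a = ((∏ i, √(depolWeight p (pauliOf (a (i, false)) (a (i, true)))) : ℝ) : ℂ) := by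
      rw [hv, Complex.ofReal_prod]
    rw [Matrix.vecMulVec_apply, Pi.star_apply, hva, Complex.star_def, Complex.conj_ofReal,
      ← Complex.ofReal_mul, ← Finset.prod_mul_distrib]
    congr 1
    exact Finset.prod_congr rfl fun i _ => Real.mul_self_sqrt (depolWeight_nonneg hp _)
  have h2 : siteOp (fun i => (Pauli.Z.ctrl (a (i, true)) : Matrix Bool Bool ℂ))
      * siteOp (fun i => (Pauli.X.ctrl (a (i, false)) : Matrix Bool Bool ℂ))
      = (∏ i, pauliPhase (a (i, false)) (a (i, true))) • pauliString (pauliStringEquiv n a) := by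
    rw [siteOp_mul]
    simp only [ctrl_Z_mul_ctrl_X, siteOp_smul]
    rfl
  -- `Z X` differs from `Y` by a phase, which cancels in the conjugation.
  rw [h1, h2, Complex.coe_smul, Matrix.conjTranspose_smul, Matrix.smul_mul, Matrix.smul_mul,
    Matrix.mul_smul, smul_smul, star_prod, ← Finset.prod_mul_distrib]
  simp only [pauliPhase_mul_star, Finset.prod_const_one, one_smul]

end Noise

/-! ### Tests on Haar random states -/

/-- The trace adds `2 ^ m` diagonal moments equal to `2 ^ (-(n + m))`, so `m` drops out. -/
theorem integral_ghse {n m : ℕ} (x y : Fin n → Bool) :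
    ∫ ψ, ghse ψ x y ∂haarState (Fin n ⊕ Fin m) = if x = y then ((2 : ℂ) ^ n)⁻¹ else 0 := by
  simp only [ghse, reduce_inl_apply]
  rw [integral_finsetSum _ fun r _ => integrable_proj_apply _ _]
  simp only [integral_proj, Sum.elim_eq_iff, and_true, Finset.sum_const, Finset.card_univ,
    Fintype.card_fun, Fintype.card_bool, Fintype.card_fin, Fintype.card_sum, nsmul_eq_mul]
  split_ifs
  · rw [pow_add]
    push_cast
    field_simp
  · simp

theorem integrable_ghse {n m : ℕ} (x y : Fin n → Bool) :
    Integrable (fun ψ => ghse ψ x y) (haarState (Fin n ⊕ Fin m)) := by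
  simp only [ghse, reduce_inl_apply]
  exact integrable_finsetSum _ fun r _ => integrable_proj_apply _ _

theorem linearMap_apply_eq_sum {ι : Type} [Fintype ι] [DecidableEq ι] (L : Matrix ι ι ℂ →ₗ[ℂ] ℂ)
    (M : Matrix ι ι ℂ) : L M = ∑ x, ∑ y, M x y * L (Matrix.single x y 1) := by
  conv_lhs => rw [Matrix.matrix_eq_sum_single M]
  rw [map_sum]
  refine Finset.sum_congr rfl fun x _ => ?_
  rw [map_sum]
  refine Finset.sum_congr rfl fun y _ => ?_
  rw [← mul_one (M x y), ← smul_eq_mul (M x y) 1, ← Matrix.smul_single, map_smul]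
  simp

/-- The average of a test over the GHSE does not depend on the mixedness parameter. -/
theorem integral_prob_ghse {n m m' : ℕ} (T : QTest (Fin n)) :
    ∫ ψ, T.prob (ghse ψ) ∂haarState (Fin n ⊕ Fin m)
      = ∫ ψ, T.prob (ghse ψ) ∂haarState (Fin n ⊕ Fin m') := by
  obtain ⟨L, hL⟩ := exists_linearMap_prob T
  -- By linearity the integral passes to the matrix entries, and the resulting expression is free of
  -- `k`.
  have h : ∀ k, ∫ ψ, T.prob (ghse ψ) ∂haarState (Fin n ⊕ Fin k)
      = (∑ x, ∑ y, (if x = y then ((2 : ℂ) ^ n)⁻¹ else 0) * L (Matrix.single x y 1)).re := by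
    intro k
    have hi : ∀ x y : Fin n → Bool, Integrable
        (fun ψ => ghse ψ x y * L (Matrix.single x y 1)) (haarState (Fin n ⊕ Fin k)) :=
      fun x y => (integrable_ghse x y).mul_const _
    simp only [hL, linearMap_apply_eq_sum L (ghse _)]
    refine (integral_re (𝕜 := ℂ) (integrable_finsetSum _ fun x _ =>
      integrable_finsetSum _ fun y _ => hi x y)).trans ?_
    rw [integral_finsetSum _ fun x _ => integrable_finsetSum _ fun y _ => hi x y]
    simp only [integral_finsetSum _ fun y _ => hi _ y, integral_mul_const, integral_ghse]
    rfl
  rw [h, h]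

/-! ### Growth of the key length -/

theorem PolyIn.add {s f g : ℕ → ℕ} (hf : PolyIn s f) (hg : PolyIn s g) :
    PolyIn s fun n => f n + g n := by
  obtain ⟨P, hP⟩ := hf
  obtain ⟨R, hR⟩ := hg
  exact ⟨P + R, fun n => by simpa using add_le_add (hP n) (hR n)⟩

theorem PolyIn.mul {s f g : ℕ → ℕ} (hf : PolyIn s f) (hg : PolyIn s g) :
    PolyIn s fun n => f n * g n := by
  obtain ⟨P, hP⟩ := hf
  obtain ⟨R, hR⟩ := hg
  exact ⟨P * R, fun n => by simpa using Nat.mul_le_mul (hP n) (hR n)⟩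

theorem PolyIn.const (s : ℕ → ℕ) (k : ℕ) : PolyIn s fun _ => k :=
  ⟨Polynomial.C k, fun n => by simp⟩

theorem PolyIn.self (s : ℕ → ℕ) : PolyIn s s :=
  ⟨Polynomial.X, fun n => by simp⟩

/-- Makes polynomial bounds in `n` polynomial in the key length. The `+ 1` absorbs the floor, which
may be zero. -/
theorem exists_le_mul_keyLen {c : ℝ} (hc : 0 < c) :
    ∃ K : ℕ, ∀ n, n ≤ K * (keyLen c n + 1) := by
  obtain ⟨K, hK⟩ := exists_nat_gt (1 / c)
  refine ⟨K, fun n => ?_⟩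
  have h1 : c * n < keyLen c n + 1 := Nat.lt_floor_add_one _
  have h2 : 1 ≤ K * c := by
    rw [div_lt_iff₀ hc] at hK
    exact hK.le
  have h3 : (n : ℝ) ≤ K * (keyLen c n + 1) := by
    have hn : (0 : ℝ) ≤ n := n.cast_nonneg
    nlinarith
  exact_mod_cast h3

theorem PolyIn.index {c : ℝ} (hc : 0 < c) : PolyIn (keyLen c) fun n => n := by
  obtain ⟨K, hK⟩ := exists_le_mul_keyLen hc
  exact ⟨Polynomial.C K * (Polynomial.X + 1), fun n => by simpa using hK n⟩

theorem tendsto_keyLen {c : ℝ} (hc : 0 < c) : Tendsto (keyLen c) atTop atTop :=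
  tendsto_nat_floor_atTop.comp (tendsto_natCast_atTop_atTop.const_mul_atTop hc)

theorem NegligibleIn.sub {lam : ℕ → ℕ} (hlam : Tendsto lam atTop atTop) {f g : ℕ → ℝ}
    (hf : NegligibleIn lam f) (hg : NegligibleIn lam g) : NegligibleIn lam fun n => f n - g n := by
  intro d
  -- The extra power of `lam n ≥ 2` absorbs the factor two from adding two bounds.
  obtain ⟨n₁, h₁⟩ := hf (d + 1)
  obtain ⟨n₂, h₂⟩ := hg (d + 1)
  obtain ⟨n₃, h₃⟩ := eventually_atTop.mp (hlam.eventually_ge_atTop 2)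
  refine ⟨max n₁ (max n₂ n₃), fun n hn => ?_⟩
  simp only [gt_iff_lt, max_lt_iff] at hn
  have hl : (2 : ℝ) ≤ lam n := by exact_mod_cast h₃ n hn.2.2.le
  have hl0 : (0 : ℝ) < (lam n : ℝ) := by linarith
  calc |f n - g n| ≤ |f n| + |g n| := abs_sub _ _
    _ < 1 / (lam n : ℝ) ^ (d + 1) + 1 / (lam n : ℝ) ^ (d + 1) := add_lt_add (h₁ n hn.1) (h₂ n hn.2.1)
    _ = (2 / lam n) * (1 / (lam n : ℝ) ^ d) := by
        rw [pow_succ]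
        field_simp
        norm_num
    _ ≤ 1 * (1 / (lam n : ℝ) ^ d) := by
        refine mul_le_mul_of_nonneg_right ?_ (by positivity)
        rw [div_le_one hl0]
        exact hl
    _ = _ := one_mul _

/-! ### Efficient generation and computational indistinguishability -/

theorem exists_qPrep_singleCopy (n : ℕ) :
    ∃ C : QPrep (Fin 1 × Fin n) (Fin n), C.size = 0 ∧
      ∀ ρ, C.output (tensorPow 1 ρ) = ρ := by
  let φ : Fin 1 × Fin n ≃ Fin n := Equiv.uniqueProd (Fin n) (Fin 1)
  obtain ⟨C, hs, hC⟩ := exists_qPrep (A := Empty) (Equiv.sumEmpty _ Empty).symm []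
    φ.symm.toEmbedding
  refine ⟨C, by simp [hs], fun ρ => ?_⟩
  rw [hC, applyGates_nil]
  ext x y
  rw [reduce_equiv, reduce_equiv]
  simp only [tensor, zeroState, basisState_apply]
  rw [if_pos (by constructor <;> exact Subsingleton.elim _ _), mul_one]
  simp only [tensorPow, Finset.univ_unique, Finset.prod_singleton]
  rfl

theorem exists_generation {lam : ℕ → ℕ} {m : ℕ → ℕ}
    {ρ : (n : ℕ) → (Fin (lam n) → Bool) → Op (Fin n)} (h : IsVPRDM lam m ρ)
    (hlam : PolyIn lam fun n => n) {p : ℕ → ℝ} (hp : ∀ n, 0 ≤ p n ∧ p n ≤ 1) :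
    ∃ G : (n : ℕ) → QPrep Empty (Fin n), PolyIn lam (fun n => (G n).size) ∧
      ∀ n, (G n).output (basisState Empty.elim) = depolarize (p n) (keyAvg (ρ n)) := by
  obtain ⟨G, hG, hGρ⟩ := h.preparable
  choose K hKs hK using fun n => exists_qPrep_randomKey (lam n)
  choose D hDs hD using fun n => exists_qPrep_depolarize n (hp n)
  choose F hFs hF using fun n => exists_comp_qPrep (K n) (G n)
  choose E hEs hE using fun n => exists_comp_qPrep (F n) (D n)
  refine ⟨E, ?_, fun n => ?_⟩
  · simp only [hEs, hFs, hKs, hDs]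
    exact ((((PolyIn.const _ 3).mul (PolyIn.self _)).add hG).add ((PolyIn.const _ 5).mul hlam))
  · rw [hE, hD, hF, hK, output_keyAvg]
    simp only [hGρ]

/-- Tests on key averages are indistinguishable from tests on the GHSE. -/
theorem IsVPRDM.indist_keyAvg {lam : ℕ → ℕ} {m : ℕ → ℕ}
    {ρ : (n : ℕ) → (Fin (lam n) → Bool) → Op (Fin n)} (h : IsVPRDM lam m ρ)
    (T : (n : ℕ) → QTest (Fin n)) (hT : PolyIn lam fun n => (T n).size) :
    NegligibleIn lam fun n => (T n).prob (keyAvg (ρ n))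
      - ∫ ψ, (T n).prob (ghse ψ) ∂haarState (Fin n ⊕ Fin (m n)) := by
  choose S hSs hS using fun n => exists_qPrep_singleCopy n
  choose A hAs hA using fun n => exists_comp_qTest (S n) (T n)
  have hpoly : PolyIn lam fun n => (A n).size := by
    simpa only [hAs, hSs, zero_add] using hT
  have := h.indist (fun _ => 1) ⟨1, fun n => by simp⟩ A hpoly
  simpa only [hA, hS, ← prob_keyAvg] using this

/-- The tester preceded by the noise circuit is again an efficient tester. Both key averages are
compared with the GHSE, whose averages agree for `m` and `m'`. -/
theorem indist_noisy {lam : ℕ → ℕ} (hlam : Tendsto lam atTop atTop) (hlam' : PolyIn lam fun n => n)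
    {m m' : ℕ → ℕ} {ρ ρ' : (n : ℕ) → (Fin (lam n) → Bool) → Op (Fin n)}
    (h : IsVPRDM lam m ρ) (h' : IsVPRDM lam m' ρ') {p : ℕ → ℝ} (hp : ∀ n, 0 ≤ p n ∧ p n ≤ 1)
    (A : (n : ℕ) → QTest (Fin n)) (hA : PolyIn lam fun n => (A n).size) :
    NegligibleIn lam fun n => (A n).prob (depolarize (p n) (keyAvg (ρ n)))
      - (A n).prob (depolarize (p n) (keyAvg (ρ' n))) := by
  choose D hDs hD using fun n => exists_qPrep_depolarize n (hp n)
  choose T hTs hT using fun n => exists_comp_qTest (D n) (A n)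
  have hpoly : PolyIn lam fun n => (T n).size := by
    simp only [hTs, hDs]
    exact ((PolyIn.const _ 5).mul hlam').add hA
  have := (h.indist_keyAvg T hpoly).sub hlam (h'.indist_keyAvg T hpoly)
  have e : ∀ n, ∫ ψ, (T n).prob (ghse ψ) ∂haarState (Fin n ⊕ Fin (m n))
      = ∫ ψ, (T n).prob (ghse ψ) ∂haarState (Fin n ⊕ Fin (m' n)) :=
    fun n => integral_prob_ghse (T n)
  simp only [e, sub_sub_sub_cancel_right] at this
  simpa only [hT, hD] using this

/-! ### Entropies of product distributions -/

theorem sum_negMulLog_mul {α β : Type} [Fintype α] [Fintype β] (f : α → ℝ) (g : β → ℝ)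
    (hf : ∑ a, f a = 1) (hg : ∑ b, g b = 1) :
    ∑ x : α × β, Real.negMulLog (f x.1 * g x.2)
      = ∑ a, Real.negMulLog (f a) + ∑ b, Real.negMulLog (g b) := by
  simp only [Real.negMulLog_mul, Fintype.sum_prod_type, Finset.sum_add_distrib,
    ← Finset.sum_mul, ← Finset.mul_sum, hf, hg, one_mul]

theorem sum_prod_eq_one {α : Type} [Fintype α] (w : α → ℝ) (hw : ∑ a, w a = 1) (n : ℕ) :
    ∑ s : Fin n → α, ∏ i, w (s i) = 1 := by
  classical
  have h := Finset.prod_univ_sum (fun _ : Fin n => (Finset.univ : Finset α)) fun _ a => w a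
  rw [Fintype.piFinset_univ] at h
  rw [← h]
  simp [hw]

theorem sum_negMulLog_prod {α : Type} [Fintype α] (w : α → ℝ) (hw : ∑ a, w a = 1) (n : ℕ) :
    ∑ s : Fin n → α, Real.negMulLog (∏ i, w (s i)) = n * ∑ a, Real.negMulLog (w a) := by
  induction n with
  | zero => simp
  | succ n ih =>
    rw [← Equiv.sum_comp (Fin.consEquiv fun _ => α)]
    simp only [Fin.consEquiv_apply, Fin.prod_univ_succ, Fin.cons_zero, Fin.cons_succ]
    rw [sum_negMulLog_mul w (fun s : Fin n → α => ∏ i, w (s i)) hw (sum_prod_eq_one w hw n), ih]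
    push_cast
    ring

theorem sum_negMulLog_const {α : Type} [Fintype α] (h : 0 < Fintype.card α) :
    ∑ _ : α, Real.negMulLog (Fintype.card α : ℝ)⁻¹ = Real.log (Fintype.card α) := by
  have h' : (Fintype.card α : ℝ) ≠ 0 := by exact_mod_cast h.ne'
  rw [Finset.sum_const, Finset.card_univ, nsmul_eq_mul, Real.negMulLog, Real.log_inv]
  field_simp

/-! ### The unscrambled states -/

/-- The eigenvalues of the unscrambled state. -/
def tagWeight (n m : ℕ) (x : Fin n → Bool) : ℝ :=
  if ∀ i : Fin n, i.val < n - m → x i = false then ((2 : ℝ) ^ m)⁻¹ else 0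

theorem tagState_eq (n m : ℕ) :
    tagState n m = Matrix.diagonal fun x => (tagWeight n m x : ℂ) := by
  unfold tagState tagWeight
  congr 1
  ext x
  split_ifs <;> simp

theorem tagWeight_nonneg (n m : ℕ) (x : Fin n → Bool) : 0 ≤ tagWeight n m x := by
  unfold tagWeight
  split_ifs <;> positivity

theorem tagWeight_le (n m : ℕ) (x : Fin n → Bool) : tagWeight n m x ≤ ((2 : ℝ) ^ m)⁻¹ := by
  unfold tagWeight
  split_ifs
  · exact le_rfl
  · positivity

theorem card_tag {n m : ℕ} (hm : m ≤ n) :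
    (Finset.univ.filter fun x : Fin n → Bool => ∀ i : Fin n, i.val < n - m → x i = false).card
      = 2 ^ m := by
  have h : (Finset.univ.filter fun x : Fin n → Bool => ∀ i : Fin n, i.val < n - m → x i = false)
      = Fintype.piFinset fun i : Fin n => if i.val < n - m then {false} else Finset.univ := by
    ext x
    simp only [Finset.mem_filter, Finset.mem_univ, true_and, Fintype.mem_piFinset]
    refine forall_congr' fun i => ?_
    split_ifs with hi <;> simp [hi]
  rw [h, Fintype.card_piFinset]
  have h2 : ∀ i : Fin n, (if i.val < n - m then ({false} : Finset Bool) else Finset.univ).card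
      = if i.val < n - m then 1 else 2 := by
    intro i
    split_ifs <;> simp
  rw [Finset.prod_congr rfl fun i _ => h2 i,
    Fin.prod_univ_eq_prod_range (fun i => if i < n - m then 1 else 2) n]
  conv_lhs => rw [← Nat.sub_add_cancel hm]
  rw [Finset.prod_range_add]
  rw [Finset.prod_congr rfl (g := fun _ => 1) fun i hi => by
    rw [if_pos]; simpa [Nat.sub_add_cancel hm] using hi]
  simp [Nat.sub_add_cancel hm]

theorem sum_tagWeight {n m : ℕ} (hm : m ≤ n) : ∑ x, tagWeight n m x = 1 := by
  simp only [tagWeight]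
  rw [← Finset.sum_filter, Finset.sum_const, card_tag hm, nsmul_eq_mul]
  push_cast
  exact mul_inv_cancel₀ (by positivity)

theorem sum_negMulLog_tagWeight {n m : ℕ} (hm : m ≤ n) :
    ∑ x, Real.negMulLog (tagWeight n m x) = m * Real.log 2 := by
  have h : ∀ x, Real.negMulLog (tagWeight n m x) = tagWeight n m x * (m * Real.log 2) := by
    intro x
    unfold tagWeight
    split_ifs
    · rw [Real.negMulLog, Real.log_inv, Real.log_pow]
      ring
    · simp
  simp only [h]
  rw [← Finset.sum_mul, sum_tagWeight hm, one_mul]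

/-! ### Upper bounds on the eigenvalues -/

section UpperBound

variable {ι : Type} [Fintype ι] [DecidableEq ι]

theorem SpectrumLE.conj {M U : Matrix ι ι ℂ} {μ : ℝ} (h : SpectrumLE M μ) (hU : U * Uᴴ = 1) :
    SpectrumLE (U * M * Uᴴ) μ := by
  intro w
  have h' := h (Uᴴ *ᵥ w)
  rw [sum_normSq_mulVec (by rwa [Matrix.conjTranspose_conjTranspose])] at h'
  convert h' using 2
  rw [Matrix.star_mulVec, Matrix.conjTranspose_conjTranspose, Matrix.dotProduct_mulVec,
    Matrix.dotProduct_mulVec, Matrix.dotProduct_mulVec, Matrix.vecMul_vecMul, Matrix.vecMul_vecMul,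
    Matrix.mul_assoc]

theorem SpectrumLE.sum {J : Type} [Fintype J] (r : J → ℝ) (hr : ∀ j, 0 ≤ r j)
    (hr1 : ∑ j, r j = 1) (M : J → Matrix ι ι ℂ) {μ : ℝ} (h : ∀ j, SpectrumLE (M j) μ) :
    SpectrumLE (∑ j, r j • M j) μ := by
  intro w
  rw [Matrix.sum_mulVec, dotProduct_sum, Complex.re_sum]
  calc _ ≤ ∑ j, r j * (μ * ∑ i, Complex.normSq (w i)) := by
        refine Finset.sum_le_sum fun j _ => ?_
        rw [Matrix.smul_mulVec, dotProduct_smul, Complex.smul_re, smul_eq_mul]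
        exact mul_le_mul_of_nonneg_left (h j w) (hr j)
    _ = _ := by rw [← Finset.sum_mul, hr1, one_mul]

theorem SpectrumLE.diagonal {d : ι → ℝ} {μ : ℝ} (h : ∀ i, d i ≤ μ) :
    SpectrumLE (Matrix.diagonal fun i => (d i : ℂ)) μ := by
  intro w
  rw [Finset.mul_sum, dotProduct, Complex.re_sum]
  refine Finset.sum_le_sum fun i _ => ?_
  have e : star w i * (Matrix.diagonal (fun i => (d i : ℂ)) *ᵥ w) i
      = ((d i * Complex.normSq (w i) : ℝ) : ℂ) := by
    rw [Matrix.mulVec_diagonal, Pi.star_apply, Complex.star_def]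
    push_cast
    rw [Complex.normSq_eq_conj_mul_self]
    ring
  rw [e, Complex.ofReal_re]
  exact mul_le_mul_of_nonneg_right (h i) (Complex.normSq_nonneg _)

end UpperBound

theorem pauliString_mul_conjTranspose {n : ℕ} (s : Fin n → Pauli) :
    pauliString s * (pauliString s)ᴴ = 1 := by
  have h : pauliString s = siteOp fun i => (s i).mat := rfl
  rw [h, conjTranspose_siteOp, siteOp_mul]
  simp only [Pauli.mat_mul_conjTranspose, siteOp_one]

theorem keyAvg_eq_sum {E : Type} [AddCommMonoid E] [Module ℝ E] {l : ℕ}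
    (f : (Fin l → Bool) → E) : keyAvg f = ∑ k, ((2 : ℝ) ^ l)⁻¹ • f k := by
  rw [keyAvg, Finset.smul_sum]

theorem sum_key (l : ℕ) : ∑ _ : Fin l → Bool, ((2 : ℝ) ^ l)⁻¹ = 1 := by
  simp

/-- Noise and key average are both mixtures of unitary conjugations, and these preserve an upper
bound on the spectrum. -/
theorem spectrumLE_depolarize {n l m : ℕ} {p : ℝ} (hp : 0 ≤ p ∧ p ≤ 1)
    (U : (Fin l → Bool) → Matrix.unitaryGroup (Fin n → Bool) ℂ) :
    SpectrumLE (depolarize p (keyAvg fun k => scrambled m (U k))) ((2 : ℝ) ^ m)⁻¹ := by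
  refine SpectrumLE.sum (fun s : Fin n → Pauli => ∏ i, depolWeight p (s i))
    (fun s => Finset.prod_nonneg fun i _ => depolWeight_nonneg hp _)
    (sum_prod_eq_one _ (sum_depolWeight p) n) _ fun s => ?_
  refine SpectrumLE.conj ?_ (pauliString_mul_conjTranspose s)
  rw [keyAvg_eq_sum]
  refine SpectrumLE.sum _ (fun _ => by positivity) (sum_key l) _ fun k => ?_
  refine SpectrumLE.conj ?_ (Matrix.mem_unitaryGroup_iff.mp (U k).2)
  rw [tagState_eq]
  exact SpectrumLE.diagonal (tagWeight_le n m)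

/-! ### The trace distance of the noisy pair -/

/-- The pure states are the columns of `pauliString s * U k`. They need not be orthogonal for
different `s` and `k`, so the entropy of the weights is only an upper bound for that of the state,
which suffices. -/
theorem depolarize_eq_mixture {n l m : ℕ} (p : ℝ)
    (U : (Fin l → Bool) → Matrix.unitaryGroup (Fin n → Bool) ℂ) :
    depolarize p (keyAvg fun k => scrambled m (U k)) =
      ∑ j : (Fin n → Pauli) × (Fin l → Bool) × (Fin n → Bool),
        (((∏ i, depolWeight p (j.1 i)) * (((2 : ℝ) ^ l)⁻¹ * tagWeight n m j.2.2) : ℝ) : ℂ) •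
        Matrix.vecMulVec (fun x => (pauliString j.1 * (U j.2.1 : Op (Fin n))) x j.2.2)
          (star fun x => (pauliString j.1 * (U j.2.1 : Op (Fin n))) x j.2.2) := by
  have hdiag : ∀ (W : Op (Fin n)), W * tagState n m * Wᴴ = ∑ z, (tagWeight n m z : ℂ) •
      Matrix.vecMulVec (fun x => W x z) (star fun x => W x z) := by
    intro W
    ext x y
    rw [tagState_eq, Matrix.mul_apply, Matrix.sum_apply]
    refine Finset.sum_congr rfl fun z _ => ?_
    rw [Matrix.mul_diagonal, Matrix.conjTranspose_apply, Matrix.smul_apply,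
      Matrix.vecMulVec_apply, Pi.star_apply, smul_eq_mul]
    ring
  rw [depolarize, Fintype.sum_prod_type]
  refine Finset.sum_congr rfl fun s _ => ?_
  rw [keyAvg_eq_sum, Matrix.mul_sum, Matrix.sum_mul, Finset.smul_sum, Fintype.sum_prod_type]
  refine Finset.sum_congr rfl fun k _ => ?_
  have e : pauliString s * (((2 : ℝ) ^ l)⁻¹ • scrambled m (U k)) * (pauliString s)ᴴ
      = ((2 : ℝ) ^ l)⁻¹ • ((pauliString s * (U k : Op (Fin n))) * tagState n m
        * (pauliString s * (U k : Op (Fin n)))ᴴ) := by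
    rw [scrambled, Matrix.mul_smul, Matrix.smul_mul, Matrix.conjTranspose_mul]
    simp only [Matrix.mul_assoc]
  rw [e, hdiag, smul_smul, Finset.smul_sum]
  refine Finset.sum_congr rfl fun z _ => ?_
  rw [← Complex.coe_smul, smul_smul]
  congr 1
  push_cast
  ring

/-- Instance of `entropy_gap_le_traceNorm` with `μ = 2 ^ (-m₁)`. The entropies of error, key and tag
string add because the weights form a product. -/
theorem entropy_gap_le_traceNorm_noisy {n l m₀ m₁ : ℕ} (hm : m₀ ≤ n) {p : ℝ}
    (hp : 0 ≤ p ∧ p ≤ 1) (U₀ U₁ : (Fin l → Bool) → Matrix.unitaryGroup (Fin n → Bool) ℂ) :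
    (m₁ - l - m₀ - n * shannonEntropy (depolWeight p)) * Real.log 2 ≤
      (1 + m₁ * Real.log 2) * traceNorm (depolarize p (keyAvg fun k => scrambled m₀ (U₀ k))
        - depolarize p (keyAvg fun k => scrambled m₁ (U₁ k))) := by
  have hlog : Real.log ((2 : ℝ) ^ m₁)⁻¹ = -(m₁ * Real.log 2) := by
    rw [Real.log_inv, Real.log_pow]
  have hkt1 : ∑ b : (Fin l → Bool) × (Fin n → Bool), ((2 : ℝ) ^ l)⁻¹ * tagWeight n m₀ b.2 = 1 := by
    rw [Fintype.sum_prod_type]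
    simp only [← Finset.mul_sum, sum_tagWeight hm, mul_one, sum_key]
  have hw1 := sum_prod_eq_one _ (sum_depolWeight p) n
  have h := entropy_gap_le_traceNorm
    (fun j : (Fin n → Pauli) × (Fin l → Bool) × (Fin n → Bool) =>
      (∏ i, depolWeight p (j.1 i)) * (((2 : ℝ) ^ l)⁻¹ * tagWeight n m₀ j.2.2))
    (fun j => mul_nonneg (Finset.prod_nonneg fun i _ => depolWeight_nonneg hp _)
      (mul_nonneg (by positivity) (tagWeight_nonneg _ _ _)))
    (by
      rw [Fintype.sum_prod_type]
      simp only [← Finset.mul_sum, hkt1, mul_one, hw1])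
    (fun j x => (pauliString j.1 * (U₀ j.2.1 : Op (Fin n))) x j.2.2)
    (fun j => by
      have hW : (pauliString j.1 * (U₀ j.2.1 : Op (Fin n)))ᴴ
          * (pauliString j.1 * (U₀ j.2.1 : Op (Fin n))) = 1 := by
        rw [mul_eq_one_comm, Matrix.conjTranspose_mul, Matrix.mul_assoc,
          ← Matrix.mul_assoc (U₀ j.2.1 : Op (Fin n)), ← Matrix.star_eq_conjTranspose
            (U₀ j.2.1 : Op (Fin n)), Matrix.mem_unitaryGroup_iff.mp (U₀ j.2.1).2, Matrix.one_mul,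
          pauliString_mul_conjTranspose]
      have h := sum_normSq_eq_conjTranspose_mul_self
        (pauliString j.1 * (U₀ j.2.1 : Op (Fin n))) j.2.2
      rw [hW, Matrix.one_apply_eq] at h
      exact_mod_cast h)
    _ (depolarize p (keyAvg fun k => scrambled m₁ (U₁ k))) (depolarize_eq_mixture p U₀)
    (μ := ((2 : ℝ) ^ m₁)⁻¹) (by positivity)
    (inv_le_one_of_one_le₀ (one_le_pow₀ (by norm_num))) (spectrumLE_depolarize hp U₁)
  have hent : ∑ j : (Fin n → Pauli) × (Fin l → Bool) × (Fin n → Bool),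
      ((∏ i, depolWeight p (j.1 i)) * (((2 : ℝ) ^ l)⁻¹ * tagWeight n m₀ j.2.2)) *
        Real.log ((∏ i, depolWeight p (j.1 i)) * (((2 : ℝ) ^ l)⁻¹ * tagWeight n m₀ j.2.2))
      = -(n * (shannonEntropy (depolWeight p) * Real.log 2) + (l * Real.log 2
        + m₀ * Real.log 2)) := by
    have h1 := sum_negMulLog_mul (fun s : Fin n → Pauli => ∏ i, depolWeight p (s i))
      (fun b : (Fin l → Bool) × (Fin n → Bool) => ((2 : ℝ) ^ l)⁻¹ * tagWeight n m₀ b.2) hw1 hkt1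
    have h2 := sum_negMulLog_mul (fun _ : Fin l → Bool => ((2 : ℝ) ^ l)⁻¹) (tagWeight n m₀)
      (sum_key l) (sum_tagWeight hm)
    have h3 : ∑ _ : Fin l → Bool, Real.negMulLog ((2 : ℝ) ^ l)⁻¹ = l * Real.log 2 := by
      have := sum_negMulLog_const (α := Fin l → Bool) Fintype.card_pos
      simpa using this
    have h4 : ∑ a, Real.negMulLog (depolWeight p a)
        = shannonEntropy (depolWeight p) * Real.log 2 := by
      rw [shannonEntropy, ← Finset.sum_div, div_mul_cancel₀]
      exact (Real.log_pos one_lt_two).ne'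
    rw [sum_negMulLog_prod _ (sum_depolWeight p), h2, h3, h4, sum_negMulLog_tagWeight hm] at h1
    rw [← h1, ← Finset.sum_neg_distrib]
    refine Finset.sum_congr rfl fun j _ => ?_
    rw [Real.negMulLog]
    ring
  rw [hent, hlog] at h
  linarith

/-! ### Asymptotics -/

/-- `P.eval 1` is the sum of the coefficients. -/
theorem eval_le_mul_pow (P : Polynomial ℕ) (n : ℕ) :
    P.eval n ≤ P.eval 1 * (n + 1) ^ P.natDegree := by
  rw [Polynomial.eval_eq_sum_range, Polynomial.eval_eq_sum_range, Finset.sum_mul]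
  refine Finset.sum_le_sum fun i hi => ?_
  rw [one_pow, mul_one]
  refine Nat.mul_le_mul_left _ ?_
  calc n ^ i ≤ (n + 1) ^ i := Nat.pow_le_pow_left n.le_succ i
    _ ≤ (n + 1) ^ P.natDegree :=
        Nat.pow_le_pow_right n.succ_pos (Nat.lt_succ_iff.mp (Finset.mem_range.mp hi))

theorem one_le_eval {P : Polynomial ℕ} (hP : P ≠ 0) {n : ℕ} (hn : 1 ≤ n) : 1 ≤ P.eval n := by
  rw [Polynomial.eval_eq_sum_range]
  calc 1 ≤ P.coeff P.natDegree * n ^ P.natDegree :=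
        Nat.mul_pos (Nat.pos_of_ne_zero (by simpa using hP)) (Nat.pow_pos hn)
    _ ≤ _ := Finset.single_le_sum (f := fun i => P.coeff i * n ^ i) (fun _ _ => Nat.zero_le _)
        (Finset.mem_range.mpr P.natDegree.lt_succ_self)

theorem mixLen_le {γ : ℝ} (hγ : γ < 1) (n : ℕ) : mixLen γ n ≤ n := by
  rw [mixLen, Nat.ceil_le]
  have hn : (0 : ℝ) ≤ n := n.cast_nonneg
  nlinarith

/-- `R` stands for the value of the slack polynomial at `n`. The floor in the key length and the
ceiling in `mixLen` can only widen the entropy gap, which is therefore at least `n / R ≥ 1 / R`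
bits; the prefactor `1 + m₁ log 2` is at most `n + 1`. -/
theorem inv_le_traceNorm_noisyPair {γ c : ℝ} {m₀ : ℕ → ℕ} {U₀ U₁ : KeyedUnitaries c}
    (h : IsEFIConstruction γ c m₀ U₀ U₁) {p : ℕ → ℝ} (hp : ∀ n, 0 ≤ p n ∧ p n ≤ 1)
    {n : ℕ} (hn : 1 ≤ n) {R : ℕ} (hR : 1 ≤ R)
    (hH : shannonEntropy (depolWeight (p n)) ≤ γ - c - (m₀ n : ℝ) / n - 1 / (R : ℝ)) :
    Real.log 2 / (R * (n + 1)) ≤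
      traceNorm (noisyPair γ c m₀ U₀ U₁ p false n - noisyPair γ c m₀ U₀ U₁ p true n) := by
  have hgap := entropy_gap_le_traceNorm_noisy (m₁ := mixLen γ n) (h.m₀_le n) (hp n) (U₀ n) (U₁ n)
  set T := traceNorm (depolarize (p n) (keyAvg fun k => scrambled (m₀ n) (U₀ n k))
        - depolarize (p n) (keyAvg fun k => scrambled (mixLen γ n) (U₁ n k)))
  change _ ≤ T
  have hT : 0 ≤ T := Finset.sum_nonneg fun i _ => Real.sqrt_nonneg _
  have hn' : (1 : ℝ) ≤ n := by exact_mod_cast hn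
  have hR' : (1 : ℝ) ≤ R := by exact_mod_cast hR
  have hl : (keyLen c n : ℝ) ≤ c * n := Nat.floor_le (by have := h.c_pos; positivity)
  have hm : γ * n ≤ (mixLen γ n : ℝ) := Nat.le_ceil _
  have hm' : (mixLen γ n : ℝ) ≤ n := by exact_mod_cast mixLen_le h.lt_one n
  have hnH : n * shannonEntropy (depolWeight (p n)) ≤ γ * n - c * n - m₀ n - n / R := by
    calc _ ≤ n * (γ - c - (m₀ n : ℝ) / n - 1 / (R : ℝ)) :=
          mul_le_mul_of_nonneg_left hH (by linarith)
      _ = _ := by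
          field_simp
  have hlog0 : 0 < Real.log 2 := Real.log_pos one_lt_two
  have hlog1 : Real.log 2 ≤ 1 := by linarith [Real.log_two_lt_d9]
  have h1 : 1 / (R : ℝ) ≤ n / R := by gcongr
  have h2 : 1 / (R : ℝ) * Real.log 2 ≤ (n + 1) * T := by
    calc 1 / (R : ℝ) * Real.log 2 ≤ (mixLen γ n - keyLen c n - m₀ n
            - n * shannonEntropy (depolWeight (p n))) * Real.log 2 := by
          refine mul_le_mul_of_nonneg_right ?_ hlog0.le
          linarith
      _ ≤ (1 + mixLen γ n * Real.log 2) * T := hgap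
      _ ≤ (n + 1) * T := by
          refine mul_le_mul_of_nonneg_right ?_ hT
          nlinarith [(mixLen γ n).cast_nonneg (α := ℝ)]
  rw [div_le_iff₀ (by positivity)]
  calc Real.log 2 = R * (1 / (R : ℝ) * Real.log 2) := by field_simp
    _ ≤ R * ((n + 1) * T) := mul_le_mul_of_nonneg_left h2 (by linarith)
    _ = T * (R * (n + 1)) := by ring

/-- The noisy pair is an EFI pair as long as the entropy of the noise is below the entropy gap. -/
theorem isEFI_noisyPair {γ c : ℝ} {m₀ : ℕ → ℕ} {U₀ U₁ : KeyedUnitaries c}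
    (h : IsEFIConstruction γ c m₀ U₀ U₁) {p : ℕ → ℝ} (hp : ∀ n, 0 ≤ p n ∧ p n ≤ 1)
    {P : Polynomial ℕ} (hP : P ≠ 0)
    (hH : ∀ᶠ n : ℕ in atTop, shannonEntropy (depolWeight (p n)) ≤
      γ - c - (m₀ n : ℝ) / n - 1 / ((P.eval n : ℕ) : ℝ)) :
    IsEFI (keyLen c) (noisyPair γ c m₀ U₀ U₁ p) where
  generation b := by
    cases b
    · exact exists_generation h.vprdm₀ (PolyIn.index h.c_pos) hp
    · exact exists_generation h.vprdm₁ (PolyIn.index h.c_pos) hp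
  far := by
    obtain ⟨K, hK⟩ := exists_le_mul_keyLen h.c_pos
    have hlog0 : 0 < Real.log 2 := Real.log_pos one_lt_two
    have h1 : 1 ≤ P.eval 1 := one_le_eval hP le_rfl
    -- The extra degree pays for the factor `n + 1`; the powers of `K + 1` come from `n + 1 ≤ (K +
    -- 1) * (keyLen c n + 1)`.
    refine ⟨P.natDegree + 1, Real.log 2 / (P.eval 1 * (K + 1) ^ (P.natDegree + 1) : ℕ), by
      have : 0 < P.eval 1 * (K + 1) ^ (P.natDegree + 1) := by positivity
      positivity, ?_⟩
    filter_upwards [hH, eventually_ge_atTop 1] with n hn hn1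
    refine le_trans ?_ (inv_le_traceNorm_noisyPair h hp hn1 (one_le_eval hP hn1) hn)
    have hb : P.eval n * (n + 1) ≤
        P.eval 1 * (K + 1) ^ (P.natDegree + 1) * (keyLen c n + 1) ^ (P.natDegree + 1) := by
      have hn2 : n + 1 ≤ (K + 1) * (keyLen c n + 1) := by nlinarith [hK n]
      calc P.eval n * (n + 1) ≤ P.eval 1 * (n + 1) ^ P.natDegree * (n + 1) :=
            Nat.mul_le_mul_right _ (eval_le_mul_pow P n)
        _ = P.eval 1 * (n + 1) ^ (P.natDegree + 1) := by ring
        _ ≤ P.eval 1 * ((K + 1) * (keyLen c n + 1)) ^ (P.natDegree + 1) :=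
            Nat.mul_le_mul_left _ (Nat.pow_le_pow_left hn2 _)
        _ = _ := by rw [mul_pow, mul_assoc]
    have hpos : 0 < P.eval n * (n + 1) := Nat.mul_pos (one_le_eval hP hn1) n.succ_pos
    rw [div_div]
    refine div_le_div_of_nonneg_left hlog0.le (by exact_mod_cast hpos) ?_
    exact_mod_cast hb
  indist A hA :=
    indist_noisy (tendsto_keyLen h.c_pos) (PolyIn.index h.c_pos) h.vprdm₀ h.vprdm₁ hp A hA

/-! ### The entropy of the noise -/

/-- One term of Gibbs' inequality; the corrections `q - w` cancel when summed over two
distributions. -/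
theorem negMulLog_le_of_pos {w q : ℝ} (hw : 0 ≤ w) (hq : 0 < q) :
    Real.negMulLog w ≤ -(w * Real.log q) + q - w := by
  rcases hw.eq_or_lt with h | h
  · simp [← h, hq.le]
  · have h1 := Real.log_le_sub_one_of_pos (div_pos hq h)
    rw [Real.log_div hq.ne' h.ne'] at h1
    have h2 := mul_le_mul_of_nonneg_left h1 h.le
    have h3 : w * (q / w - 1) = q - w := by field_simp
    rw [h3] at h2
    rw [Real.negMulLog]
    linarith

/-- The tangent at `p = 1/4` bounds the entropy of the depolarizing noise. -/
theorem shannonEntropy_depolWeight_le {p : ℝ} (hp : 0 ≤ p ∧ p ≤ 1) :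
    shannonEntropy (depolWeight p) ≤ 3 / 10 * (1 - 3 * p / 4) + 3 * p := by
  have hlog0 : 0 < Real.log 2 := Real.log_pos one_lt_two
  have h16 : Real.log (1 / 16) = -(4 * Real.log 2) := by
    rw [show (1 / 16 : ℝ) = (2 ^ 4)⁻¹ by norm_num, Real.log_inv, Real.log_pow]
    norm_num
  -- The reference weights `13/16` and `1/16` are those of `p = 1/4`. The rational bound `3/10` for
  -- the binary logarithm of `16/13` amounts to `(16/13)^10 ≤ 2^3`.
  have h13 : -Real.log (13 / 16) ≤ 3 / 10 * Real.log 2 := by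
    have h : Real.log ((16 / 13) ^ 10) ≤ Real.log (2 ^ 3) :=
      Real.log_le_log (by positivity) (by norm_num)
    rw [Real.log_pow, Real.log_pow, show (16 / 13 : ℝ) = (13 / 16)⁻¹ by norm_num,
      Real.log_inv] at h
    push_cast at h
    linarith
  have hI := negMulLog_le_of_pos (w := 1 - 3 * p / 4) (q := 13 / 16) (by linarith) (by norm_num)
  have hX := negMulLog_le_of_pos (w := p / 4) (q := 1 / 16) (by linarith) (by norm_num)
  have h13' := mul_le_mul_of_nonneg_left h13 (show 0 ≤ 1 - 3 * p / 4 by linarith)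
  rw [h16] at hX
  rw [shannonEntropy, ← Finset.sum_div, div_le_iff₀ hlog0, sum_pauli]
  simp only [depolWeight]
  linarith

theorem tendsto_log_pow_div (a : ℕ) :
    Tendsto (fun n : ℕ => Real.log n ^ a / (n : ℝ)) atTop (nhds 0) := by
  have h := (isLittleO_log_rpow_rpow_atTop (a : ℝ) one_pos).tendsto_div_nhds_zero.comp
    tendsto_natCast_atTop_atTop
  refine h.congr fun n => ?_
  simp

theorem isEFI_noisyPair_of_lt_quarter {γ c : ℝ} (hc : c = 1 / 2 * 10 ^ (-4 : ℤ)) (hγ : γ = 1 - c)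
    {m₀ : ℕ → ℕ} {U₀ U₁ : KeyedUnitaries c} (h : IsEFIConstruction γ c m₀ U₀ U₁)
    {a : ℕ} {g : ℕ → ℝ} (hg : g =O[atTop] fun n : ℕ => Real.log n ^ a / (n : ℝ))
    {p : ℕ → ℝ} (hp : ∀ n, 0 ≤ p n ∧ p n ≤ 1) (hpg : ∀ᶠ n : ℕ in atTop, p n < 1 / 4 - g n) :
    IsEFI (keyLen c) (noisyPair γ c m₀ U₀ U₁ p) := by
  -- A constant gap remains in the limit, so the slack `1 / n` is affordable.
  refine isEFI_noisyPair h hp Polynomial.X_ne_zero ?_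
  have hg0 : Tendsto g atTop (nhds 0) := hg.trans_tendsto (tendsto_log_pow_div a)
  have hm0 : Tendsto (fun n => (m₀ n : ℝ) / n) atTop (nhds 0) := by
    obtain ⟨b, hb⟩ := h.m₀_polylog
    refine Asymptotics.IsBigO.trans_tendsto ?_ (tendsto_log_pow_div b)
    simpa only [div_eq_mul_inv] using hb.mul (Asymptotics.isBigO_refl (fun n : ℕ => (n : ℝ)⁻¹) atTop)
  have hn0 : Tendsto (fun n : ℕ => 1 / (n : ℝ)) atTop (nhds 0) := tendsto_one_div_atTop_nhds_zero_nat
  -- Only a lower bound on `g` is needed. The three tolerances are convenient choices that together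
  -- stay within the margin of about `0.006` between `0.99375` and `0.9999`.
  filter_upwards [hpg, hg0.eventually (lt_mem_nhds (show (-1 / 10000 : ℝ) < 0 by norm_num)),
    hm0.eventually (gt_mem_nhds (show (0 : ℝ) < 1 / 1000 by norm_num)),
    hn0.eventually (gt_mem_nhds (show (0 : ℝ) < 1 / 1000 by norm_num))] with n h1 h2 h3 h4
  have hH := shannonEntropy_depolWeight_le (hp n)
  have hc' : c = 1 / 20000 := by
    rw [hc]
    norm_num
  rw [Polynomial.eval_X]
  linarith

end NoisyEFI

end

theorem mainTheorem8 :
    (∀ (γ c : ℝ) (m₀ : ℕ → ℕ) (U₀ U₁ : NoisyEFI.KeyedUnitaries c),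
      NoisyEFI.IsEFIConstruction γ c m₀ U₀ U₁ →
      ∀ p : ℕ → ℝ, (∀ n, 0 ≤ p n ∧ p n ≤ 1) →
      ∀ P : Polynomial ℕ, P ≠ 0 →
      (∀ᶠ n : ℕ in Filter.atTop,
        NoisyEFI.shannonEntropy (NoisyEFI.depolWeight (p n)) ≤
          γ - c - (m₀ n : ℝ) / n - 1 / ((P.eval n : ℕ) : ℝ)) →
      NoisyEFI.IsEFI (NoisyEFI.keyLen c) (NoisyEFI.noisyPair γ c m₀ U₀ U₁ p)) ∧
    (∀ (γ c : ℝ), c = 1 / 2 * 10 ^ (-4 : ℤ) → γ = 1 - c →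
      ∀ (m₀ : ℕ → ℕ) (U₀ U₁ : NoisyEFI.KeyedUnitaries c),
      NoisyEFI.IsEFIConstruction γ c m₀ U₀ U₁ →
      ∀ (a : ℕ) (g : ℕ → ℝ), g =O[Filter.atTop] (fun n : ℕ => Real.log n ^ a / (n : ℝ)) →
      ∀ p : ℕ → ℝ, (∀ n, 0 ≤ p n ∧ p n ≤ 1) →
      (∀ᶠ n : ℕ in Filter.atTop, p n < 1 / 4 - g n) →
      NoisyEFI.IsEFI (NoisyEFI.keyLen c) (NoisyEFI.noisyPair γ c m₀ U₀ U₁ p)) :=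
  ⟨fun _ _ _ _ _ h _ hp _ hP hH => NoisyEFI.isEFI_noisyPair h hp hP hH,
    fun _ _ hc hγ _ _ _ h _ _ hg _ hp hpg =>
      NoisyEFI.isEFI_noisyPair_of_lt_quarter hc hγ h hg hp hpg⟩
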